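/- All graphs are finite, simple and undirected. A set $F$ of edges of a graph $G$ is an \emph{edge dominating set} if every edge of $G$ belongs to $F$ or shares a vertex with an edge of $F$, and $G$ is \emph{well-edge-dominated} if all of its inclusion-minimal edge dominating sets have the same cardinality. A graph is \emph{outerplanar} if it has a planar drawing with every vertex on the boundary of the outer face, and it is \emph{2-connected} if it is connected, has at least three vertices and has no cut-vertex (for an outerplanar graph on at least three vertices this means that all its vertices lie on a cycle that bounds the outer face of a drawing). Let $G$ be a 2-connected outerplanar graph. Then $G$ is well-edge-dominated if and only if $G$ is isomorphic to one of the eight graphs $$C_3,\quad C_4,\quad C_5,\quad \mathcal{H},\quad F_5,\quad C_7,\quad C_7^*,\quad \mathcal{DH}.$$ Here $C_n$ is the cycle on $n$ vertices; $\mathcal{H}$, the house, has vertices $1,\dots,5$ and edges $12, 13, 24, 34, 35, 45$; $F_5$, the fan on five vertices, is the join of $K_1$ and the path $P_4$; $C_7^*$ is $C_7$ together with one chord joining two vertices at distance three; and $\mathcal{DH}$, the dream house, has vertices $1,\dots,7$ and edges $12, 13, 24, 34, 35, 46, 56, 57, 67$. -/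

import Mathlib

namespace WellEdgeDominated

/-! ### Edge domination -/

/-- `F` is an edge dominating set of `G`: a set of edges of `G` such that every edge of `G` is in
`F` or shares a vertex with an edge in `F`. -/
def IsEdgeDominating {V : Type*} (G : SimpleGraph V) (F : Finset (Sym2 V)) : Prop :=
  (∀ e ∈ F, e ∈ G.edgeSet) ∧
    ∀ e ∈ G.edgeSet, e ∈ F ∨ ∃ f ∈ F, ∃ v : V, v ∈ e ∧ v ∈ f

/-- All inclusion-minimal edge dominating sets of `G` have the same cardinality. -/
def IsWellEdgeDominated {V : Type*} (G : SimpleGraph V) : Prop :=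
  ∀ F₁ F₂ : Finset (Sym2 V),
    Minimal (IsEdgeDominating G) F₁ → Minimal (IsEdgeDominating G) F₂ → F₁.card = F₂.card

/-! ### Outerplanar graphs -/

/-- A planar drawing of `G`, with `ℂ` as the plane: the vertices are distinct points, each edge is
a simple arc joining its two ends, an edge passes through no vertex other than its ends, and
two different edges meet only in a common end. -/
structure PlaneDrawing {V : Type*} (G : SimpleGraph V) where
  /-- the point that represents a vertex -/
  point : V → ℂ
  /-- the arc that represents an edge (the value at a non-edge is never used) -/
  arc : Sym2 V → Set ℂ
  point_injective : Function.Injective point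
  isArc : ∀ u v : V, G.Adj u v →
    ∃ γ : Path (point u) (point v), Function.Injective γ ∧ Set.range γ = arc s(u, v)
  point_mem_arc : ∀ w : V, ∀ e ∈ G.edgeSet, point w ∈ arc e → w ∈ e
  arc_inter : ∀ e ∈ G.edgeSet, ∀ f ∈ G.edgeSet, e ≠ f →
    ∀ x : ℂ, x ∈ arc e → x ∈ arc f → ∃ v : V, v ∈ e ∧ v ∈ f ∧ x = point v

/-- The set of all points of the plane that lie on the drawing. -/
def PlaneDrawing.support {V : Type*} {G : SimpleGraph V} (D : PlaneDrawing G) : Set ℂ :=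
  Set.range D.point ∪ ⋃ e ∈ G.edgeSet, D.arc e

/-- The outer face: the points off the drawing whose connected component in the complement of
the drawing is unbounded. (For a finite graph there is exactly one unbounded component.) -/
def PlaneDrawing.outerFace {V : Type*} {G : SimpleGraph V} (D : PlaneDrawing G) : Set ℂ :=
  {x | x ∈ D.supportᶜ ∧ ¬ Bornology.IsBounded (connectedComponentIn D.supportᶜ x)}

/-- `G` has a planar drawing with every vertex on (the boundary of) the outer face. -/
def IsOuterplanar {V : Type*} (G : SimpleGraph V) : Prop :=
  ∃ D : PlaneDrawing G, ∀ v : V, D.point v ∈ frontier D.outerFace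

/-- `G` is 2-connected: connected, with at least three vertices and no cut-vertex. -/
def IsTwoConnected {V : Type*} [Fintype V] (G : SimpleGraph V) : Prop :=
  3 ≤ Fintype.card V ∧ G.Connected ∧ ∀ v : V, (G.induce ({v}ᶜ : Set V)).Connected

/-! ### The special graphs -/

/-- The join of two graphs: their disjoint union together with all edges between them. -/
def join {V W : Type*} (G : SimpleGraph V) (H : SimpleGraph W) : SimpleGraph (V ⊕ W) :=
  (G ⊕g H) ⊔ completeBipartiteGraph V W

/-- The fan `F_n` on `n ≥ 1` vertices: the join of `K_1` and the path `P_{n-1}`. -/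
def fan (n : ℕ) : SimpleGraph (Fin 1 ⊕ Fin (n - 1)) :=
  join (⊤ : SimpleGraph (Fin 1)) (SimpleGraph.pathGraph (n - 1))

/-- The graph `C_7^*`: the cycle `C_7` with a chord between two vertices at distance three. -/
def cycleSevenStar : SimpleGraph (Fin 7) :=
  SimpleGraph.cycleGraph 7 ⊔ SimpleGraph.edge 0 3

/-- The house: the square `0,1,3,2` with the triangle `2,3,4` on top of its side `2,3`. -/
def house : SimpleGraph (Fin 5) :=
  SimpleGraph.fromEdgeSet {s(0, 1), s(0, 2), s(2, 3), s(1, 3), s(3, 4), s(2, 4)}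

/-- The dream house: two stacked squares `0,1,3,2` and `2,3,5,4` sharing the side `2,3`, with the
triangle `4,5,6` on top of the side `4,5`. -/
def dreamHouse : SimpleGraph (Fin 7) :=
  SimpleGraph.fromEdgeSet
    {s(0, 1), s(0, 2), s(1, 3), s(2, 3), s(2, 4), s(3, 5), s(4, 5), s(4, 6), s(5, 6)}

end WellEdgeDominated

/-!
A 2-connected outerplanar graph is a Hamiltonian cycle with noncrossing chords. Once this is known,
the classification is a short argument about matchings along the cycle.

The topological input is that an outerplanar graph contains no subdivision of `K₄` or `K₂,₃`. The
outer face is connected and comes arbitrarily close to every vertex, so a new point in it can be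
joined to all vertices; a subdivision of `K₄` or `K₂,₃` would then give a drawing of `K₅` or `K₃,₃`
in which independent edges are disjoint. No Jordan curve theorem is needed to rule this out: the
van Kampen obstruction is computed directly. If `γ` and `δ` are disjoint paths, `γ s - δ t` has a
continuous square root on the square, which gives a parity relation between the four sides of the
square (`pathSign_parity`). Summed over all pairs of independent edges of `K₅` or `K₃,₃`, these
relations read `0 = 1` in `ZMod 2`. In this argument edges with a common end may meet arbitrarily,
which is why the new edges through the outer face may be chosen without care near the vertices, and
why it suffices to find branch walks in the graph rather than an honest subdivision.

A longest cycle is Hamiltonian, since an ear at a missed vertex would either lengthen it or give a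
`K₂,₃` (`exists_hamiltonian_labeling`), and its chords do not cross, since crossing chords give a
`K₄` (`IsCyclicLabeling.not_crossing`).

Maximal matchings are minimal edge dominating sets. Comparing a near-perfect matching along the
cycle with one that misses two more vertices, at successive distances three, forces chords of length
three or six at every rotation of the cycle; for even length at least six and for odd length at
least nine these chords cross (`IsCyclicLabeling.length_le_seven`). The remaining lengths are
`3`, `4`, `5` and `7`, where few sets of noncrossing chords survive. Conversely, each of the eight
graphs has at most nine edges and is checked by evaluation.
-/

namespace WellEdgeDominated

/-! ### Continuous square roots along paths -/

/-- `f 1 / f 0` for a continuous square root `f` of `g`; for nonvanishing `g` it does not depend on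
the choice of `f`. -/
noncomputable def sqrtRatio (g : ℝ → ℂ) : ℂ :=
  open Classical in
  if h : ∃ f : ℝ → ℂ, Continuous f ∧ ∀ t, f t ^ 2 = g t then h.choose 1 / h.choose 0 else 1

lemma sqrtRatio_eq {f g : ℝ → ℂ} (hf : Continuous f) (hfg : ∀ t, f t ^ 2 = g t)
    (hg : ∀ t, g t ≠ 0) : sqrtRatio g = f 1 / f 0 := by
  have h : ∃ f : ℝ → ℂ, Continuous f ∧ ∀ t, f t ^ 2 = g t := ⟨f, hf, hfg⟩
  have hf0 : ∀ t, f t ≠ 0 := fun t h0 ↦ hg t (by rw [← hfg, h0]; simp)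
  rw [sqrtRatio, dif_pos h]
  obtain ⟨hc, hs⟩ := h.choose_spec
  rcases isPreconnected_univ.eq_or_eq_neg_of_sq_eq hc.continuousOn hf.continuousOn
    (fun t _ ↦ by simp [hs, hfg]) (fun {t} _ ↦ hf0 t) with h' | h'
  · rw [h' (Set.mem_univ 1), h' (Set.mem_univ 0)]
  · rw [h' (Set.mem_univ 1), h' (Set.mem_univ 0)]
    simp

lemma isSimplyConnected_univ_of_vectorSpace {E : Type*} [AddCommGroup E] [Module ℝ E]
    [TopologicalSpace E] [ContinuousAdd E] [ContinuousSMul ℝ E] :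
    IsSimplyConnected (Set.univ : Set E) := by
  have : SimplyConnectedSpace E := inferInstance
  exact (Homeomorph.Set.univ E).toHomotopyEquiv.simplyConnectedSpace

lemma exists_continuous_sqrt {E : Type*} [AddCommGroup E] [Module ℝ E]
    [TopologicalSpace E] [ContinuousAdd E] [ContinuousSMul ℝ E] [LocallyPathConnectedSpace E]
    {g : E → ℂ} (hc : Continuous g) (hg : ∀ t, g t ≠ 0) :
    ∃ f : E → ℂ, Continuous f ∧ ∀ t, f t ^ 2 = g t := by
  obtain ⟨f, hf, hfg⟩ := Complex.exists_continuousOn_pow_eq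
    (isSimplyConnected_univ_of_vectorSpace (E := E)) isOpen_univ hc.continuousOn
    (by rintro ⟨t, -, h⟩; exact hg t h) two_ne_zero
  exact ⟨f, by simpa using hf, hfg⟩

lemma sqrtRatio_sq {g : ℝ → ℂ} (hc : Continuous g) (hg : ∀ t, g t ≠ 0) :
    sqrtRatio g ^ 2 = g 1 / g 0 := by
  obtain ⟨f, hf, hfg⟩ := exists_continuous_sqrt hc hg
  rw [sqrtRatio_eq hf hfg hg, div_pow, hfg, hfg]

lemma sqrtRatio_neg {g : ℝ → ℂ} (hc : Continuous g) (hg : ∀ t, g t ≠ 0) :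
    sqrtRatio (fun t ↦ -g t) = sqrtRatio g := by
  obtain ⟨f, hf, hfg⟩ := exists_continuous_sqrt hc hg
  rw [sqrtRatio_eq hf hfg hg, sqrtRatio_eq (f := fun t ↦ Complex.I * f t) (by fun_prop)
    (by intro t; simp [mul_pow, hfg]) (by simpa using hg)]
  exact mul_div_mul_left _ _ Complex.I_ne_zero

/-- The square root ratio of a path `γ` seen from a point `w`. -/
noncomputable def pathRatio {u v : ℂ} (γ : Path u v) (w : ℂ) : ℂ :=
  sqrtRatio fun t ↦ γ.extend t - w

lemma extend_mem_range {u v : ℂ} (γ : Path u v) (t : ℝ) : γ.extend t ∈ Set.range γ := by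
  rw [← γ.extend_range]; exact ⟨t, rfl⟩

lemma pathRatio_sq {u v w : ℂ} (γ : Path u v) (hw : w ∉ Set.range γ) :
    pathRatio γ w ^ 2 = (v - w) / (u - w) := by
  have h : ∀ t, γ.extend t - w ≠ 0 := fun t ht ↦
    hw (by rw [← sub_eq_zero.1 ht]; exact extend_mem_range γ t)
  rw [pathRatio, sqrtRatio_sq (by fun_prop) h]
  simp

/-- A continuous square root of `γ s - δ t` on the square relates the four sides of the square. -/
lemma pathRatio_mul {u v w z : ℂ} (γ : Path u v) (δ : Path w z)
    (h : Disjoint (Set.range γ) (Set.range δ)) :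
    pathRatio γ w * pathRatio δ v = pathRatio γ z * pathRatio δ u := by
  have h0 : ∀ s t, γ.extend s - δ.extend t ≠ 0 := fun s t hst ↦
    Set.disjoint_left.1 h (extend_mem_range γ s)
      (by rw [sub_eq_zero.1 hst]; exact extend_mem_range δ t)
  obtain ⟨f, hf, hfg⟩ := exists_continuous_sqrt (E := ℝ × ℝ)
    (g := fun x ↦ γ.extend x.1 - δ.extend x.2) (by fun_prop) (fun x ↦ h0 _ _)
  have hf0 : ∀ x, f x ≠ 0 := fun x hx ↦ h0 x.1 x.2 (by rw [← hfg, hx]; simp)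
  have e1 : pathRatio γ w = f (1, 0) / f (0, 0) := by
    refine sqrtRatio_eq (f := fun s ↦ f (s, 0)) (by fun_prop) (fun s ↦ ?_) fun s ↦ ?_
    · simp [hfg]
    · simpa using h0 s 0
  have e2 : pathRatio γ z = f (1, 1) / f (0, 1) := by
    refine sqrtRatio_eq (f := fun s ↦ f (s, 1)) (by fun_prop) (fun s ↦ ?_) fun s ↦ ?_
    · simp [hfg]
    · simpa using h0 s 1
  have e3 : pathRatio δ v = f (1, 1) / f (1, 0) := by
    have hv : ∀ t, v - δ.extend t ≠ 0 := fun t ↦ by simpa using h0 1 t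
    rw [pathRatio, ← sqrtRatio_neg (by fun_prop)
      (fun t ht ↦ hv t (by rw [← neg_sub, ht, neg_zero]))]
    simp only [neg_sub]
    exact sqrtRatio_eq (f := fun t ↦ f (1, t)) (by fun_prop) (fun t ↦ by simp [hfg]) hv
  have e4 : pathRatio δ u = f (0, 1) / f (0, 0) := by
    have hv : ∀ t, u - δ.extend t ≠ 0 := fun t ↦ by simpa using h0 0 t
    rw [pathRatio, ← sqrtRatio_neg (by fun_prop)
      (fun t ht ↦ hv t (by rw [← neg_sub, ht, neg_zero]))]
    simp only [neg_sub]
    exact sqrtRatio_eq (f := fun t ↦ f (0, t)) (by fun_prop) (fun t ↦ by simp [hfg]) hv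
  rw [e1, e2, e3, e4]
  have := hf0 (0, 0); have := hf0 (0, 1); have := hf0 (1, 0); have := hf0 (1, 1)
  field_simp

/-! ### Parity of disjoint paths -/

/-- The nontrivial character of `ZMod 2`, with values `1` and `-1`. -/
noncomputable def signChar (a : ZMod 2) : ℂ := if a = 0 then 1 else -1

lemma signChar_add (a b : ZMod 2) : signChar (a + b) = signChar a * signChar b := by
  have : ∀ a : ZMod 2, a = 0 ∨ a = 1 := by decide
  have h11 : (1 + 1 : ZMod 2) = 0 := by decide
  rcases this a with rfl | rfl <;> rcases this b with rfl | rfl <;> simp [signChar, h11]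

lemma signChar_eq_one {a : ZMod 2} (h : signChar a = 1) : a = 0 := by
  by_contra ha
  rw [signChar, if_neg ha] at h
  norm_num at h

lemma signChar_ne_zero (a : ZMod 2) : signChar a ≠ 0 := by
  rw [signChar]; split_ifs <;> simp

/-- A square root of `x - y`. -/
noncomputable def diffRoot (x y : ℂ) : ℂ := (x - y) ^ (2⁻¹ : ℂ)

lemma diffRoot_sq (x y : ℂ) : diffRoot x y ^ 2 = x - y := by
  simp [diffRoot]

lemma diffRoot_ne_zero {x y : ℂ} (h : x ≠ y) : diffRoot x y ≠ 0 := fun h0 ↦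
  h (sub_eq_zero.1 (by rw [← diffRoot_sq, h0]; simp))

/-- The sign by which `diffRoot x y` differs from `I * diffRoot y x`. -/
noncomputable def swapSign (x y : ℂ) : ZMod 2 :=
  open Classical in if diffRoot x y = Complex.I * diffRoot y x then 0 else 1

lemma diffRoot_swap (x y : ℂ) :
    diffRoot x y = signChar (swapSign x y) * (Complex.I * diffRoot y x) := by
  rw [swapSign]
  split_ifs with h
  · simpa [signChar] using h
  · have : diffRoot x y ^ 2 = (Complex.I * diffRoot y x) ^ 2 := by
      rw [mul_pow, diffRoot_sq, diffRoot_sq, Complex.I_sq]; ring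
    rcases sq_eq_sq_iff_eq_or_eq_neg.1 this with h' | h'
    · exact absurd h' h
    · simpa [signChar] using h'

lemma swapSign_add_swapSign {x y : ℂ} (h : x ≠ y) : swapSign x y + swapSign y x = 1 := by
  have h1 := diffRoot_swap x y
  rw [diffRoot_swap y x] at h1
  have h0 := diffRoot_ne_zero h
  have h2 : signChar (swapSign x y + swapSign y x + 1) = 1 := by
    rw [signChar_add, signChar_add]
    have : signChar 1 = -1 := by simp [signChar]
    rw [this]
    refine mul_right_cancel₀ h0 ?_
    linear_combination -h1 - signChar (swapSign x y) * signChar (swapSign y x) * diffRoot x y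
      * Complex.I_sq
  have h3 := signChar_eq_one h2
  have h4 : (1 + 1 : ZMod 2) = 0 := by decide
  linear_combination h3 - h4

/-- The sign by which the square root ratio of `γ` seen from `w` differs from the one obtained
from the fixed roots `diffRoot` at both ends. -/
noncomputable def pathSign {u v : ℂ} (γ : Path u v) (w : ℂ) : ZMod 2 :=
  open Classical in if pathRatio γ w = diffRoot v w / diffRoot u w then 0 else 1

lemma pathRatio_eq {u v w : ℂ} (γ : Path u v) (hw : w ∉ Set.range γ) :
    pathRatio γ w = signChar (pathSign γ w) * (diffRoot v w / diffRoot u w) := by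
  rw [pathSign]
  split_ifs with h
  · simpa [signChar] using h
  · have : pathRatio γ w ^ 2 = (diffRoot v w / diffRoot u w) ^ 2 := by
      rw [div_pow, diffRoot_sq, diffRoot_sq, pathRatio_sq γ hw]
    rcases sq_eq_sq_iff_eq_or_eq_neg.1 this with h' | h'
    · exact absurd h' h
    · simpa [signChar] using h'

/-- Disjoint paths cross an even number of times: the local form of the van Kampen obstruction. -/
lemma pathSign_parity {u v w z : ℂ} (γ : Path u v) (δ : Path w z)
    (h : Disjoint (Set.range γ) (Set.range δ)) :
    pathSign γ w + pathSign γ z + pathSign δ u + pathSign δ v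
      + (swapSign v w + swapSign z v + swapSign z u + swapSign u w) = 0 := by
  have hu : u ∈ Set.range γ := ⟨0, γ.source⟩
  have hv : v ∈ Set.range γ := ⟨1, γ.target⟩
  have hw : w ∈ Set.range δ := ⟨0, δ.source⟩
  have hz : z ∈ Set.range δ := ⟨1, δ.target⟩
  have hd := Set.disjoint_left.1 h
  have key := pathRatio_mul γ δ h
  rw [pathRatio_eq γ fun h' ↦ hd h' hw, pathRatio_eq γ fun h' ↦ hd h' hz, pathRatio_eq δ (hd hu),
    pathRatio_eq δ (hd hv), diffRoot_swap v w, diffRoot_swap z v, diffRoot_swap u w,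
    diffRoot_swap z u] at key
  have h1 : diffRoot w v ≠ 0 := diffRoot_ne_zero fun h ↦ hd hv (h ▸ hw)
  have h2 : diffRoot v z ≠ 0 := diffRoot_ne_zero fun h ↦ hd hv (h ▸ hz)
  have h3 : diffRoot w u ≠ 0 := diffRoot_ne_zero fun h ↦ hd hu (h ▸ hw)
  have h4 : diffRoot u z ≠ 0 := diffRoot_ne_zero fun h ↦ hd hu (h ▸ hz)
  have hI := Complex.I_ne_zero
  have hx := signChar_ne_zero (swapSign u w)
  have hsq : ∀ a, signChar a * signChar a = 1 := fun a ↦ by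
    rw [signChar]; split_ifs <;> simp
  field_simp at key
  apply signChar_eq_one
  simp only [signChar_add]
  have hr : signChar (swapSign u w) * signChar (pathSign γ z) * signChar (pathSign δ u) *
      signChar (swapSign z u) * (signChar (swapSign u w) * signChar (pathSign γ z) *
        signChar (pathSign δ u) * signChar (swapSign z u)) = 1 := by
    simpa only [signChar_add] using
      hsq (swapSign u w + pathSign γ z + pathSign δ u + swapSign z u)
  rw [← hr]
  nth_rewrite 1 [← key]
  ring

/-- No drawing of `K₅` in the plane keeps independent edges disjoint. -/
theorem not_drawing_completeGraph_five (p : Fin 5 → ℂ) (hp : Function.Injective p)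
    (A : Fin 5 → Fin 5 → Set ℂ) (hA : ∀ i j, i < j → JoinedIn (A i j) (p i) (p j))
    (hd : ∀ i j k l, i < j → k < l → i ≠ k → i ≠ l → j ≠ k → j ≠ l →
      Disjoint (A i j) (A k l)) : False := by
  have hγ : ∀ i j, ∃ γ : Path (p i) (p j), i < j → Set.range γ ⊆ A i j := by
    intro i j
    by_cases h : i < j
    · exact ⟨(hA i j h).somePath, fun _ ↦ Set.range_subset_iff.2 (hA i j h).somePath_mem⟩
    · exact ⟨(PathConnectedSpace.joined (p i) (p j)).somePath, fun h' ↦ absurd h' h⟩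
  choose γ hγ using hγ
  set n : Fin 5 → Fin 5 → Fin 5 → ZMod 2 := fun i j k ↦ pathSign (γ i j) (p k)
  set s : Fin 5 → Fin 5 → ZMod 2 := fun i j ↦ swapSign (p i) (p j)
  have e : ∀ i j k l : Fin 5, (i < j ∧ k < l ∧ i ≠ k ∧ i ≠ l ∧ j ≠ k ∧ j ≠ l) →
      n i j k + n i j l + n k l i + n k l j + (s j k + s l j + s l i + s i k) = 0 :=
    fun i j k l ⟨h1, h2, h3, h4, h5, h6⟩ ↦
      pathSign_parity _ _ ((hd i j k l h1 h2 h3 h4 h5 h6).mono (hγ _ _ h1) (hγ _ _ h2))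
  have hs : ∀ i j, i ≠ j → s i j = 1 + s j i := fun i j h ↦ by
    linear_combination swapSign_add_swapSign (hp.ne h) - s j i * CharTwo.two_eq_zero (R := ZMod 2)
  clear_value n s
  -- Each `n i j k` occurs in exactly two of the fifteen relations, so their sum reads `1 = 0`.
  have h0 := e 0 1 2 3 (by decide)
  have h1 := e 0 1 2 4 (by decide)
  have h2 := e 0 1 3 4 (by decide)
  have h3 := e 0 2 1 3 (by decide)
  have h4 := e 0 2 1 4 (by decide)
  have h5 := e 0 2 3 4 (by decide)
  have h6 := e 0 3 1 2 (by decide)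
  have h7 := e 0 3 1 4 (by decide)
  have h8 := e 0 3 2 4 (by decide)
  have h9 := e 0 4 1 2 (by decide)
  have h10 := e 0 4 1 3 (by decide)
  have h11 := e 0 4 2 3 (by decide)
  have h12 := e 1 2 3 4 (by decide)
  have h13 := e 1 3 2 4 (by decide)
  have h14 := e 1 4 2 3 (by decide)
  have sw := fun i j (h : i < j) ↦ hs j i h.ne'
  grind

/-- No drawing of `K₃,₃` in the plane keeps independent edges disjoint. -/
theorem not_drawing_completeBipartite_three (p q : Fin 3 → ℂ)
    (hpq : Function.Injective (Sum.elim p q)) (A : Fin 3 → Fin 3 → Set ℂ)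
    (hA : ∀ i j, JoinedIn (A i j) (p i) (q j))
    (hd : ∀ i j k l, i ≠ k → j ≠ l → Disjoint (A i j) (A k l)) : False := by
  have hγ : ∀ i j, ∃ γ : Path (p i) (q j), Set.range γ ⊆ A i j := fun i j ↦
    ⟨(hA i j).somePath, Set.range_subset_iff.2 (hA i j).somePath_mem⟩
  choose γ hγ using hγ
  set m : Fin 3 → Fin 3 → Fin 3 → ZMod 2 := fun i j k ↦ pathSign (γ i j) (p k)
  set n : Fin 3 → Fin 3 → Fin 3 → ZMod 2 := fun i j k ↦ pathSign (γ i j) (q k)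
  set s : Fin 3 → Fin 3 → ZMod 2 := fun i j ↦ swapSign (p i) (p j)
  set t : Fin 3 → Fin 3 → ZMod 2 := fun i j ↦ swapSign (q i) (q j)
  set r : Fin 3 → Fin 3 → ZMod 2 := fun i j ↦ swapSign (q i) (p j)
  have e : ∀ i j k l : Fin 3, (i ≠ k ∧ j ≠ l) →
      m i j k + n i j l + m k l i + n k l j + (r j k + t l j + r l i + s i k) = 0 :=
    fun i j k l ⟨h1, h2⟩ ↦
      pathSign_parity _ _ ((hd i j k l h1 h2).mono (hγ _ _) (hγ _ _))
  have ht : ∀ i j, i < j → t j i = 1 + t i j := fun i j h ↦ by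
    have h1 : t j i + t i j = 1 := swapSign_add_swapSign ((hpq.comp Sum.inr_injective).ne h.ne')
    linear_combination h1 - t i j * CharTwo.two_eq_zero (R := ZMod 2)
  clear_value m n s t r
  -- Each `m i j k` and each `n i j k` occurs in exactly two of the eighteen relations, so their
  -- sum reads `1 = 0`.
  have h0 := e 0 0 1 1 (by decide)
  have h1 := e 0 0 1 2 (by decide)
  have h2 := e 0 1 1 0 (by decide)
  have h3 := e 0 1 1 2 (by decide)
  have h4 := e 0 2 1 0 (by decide)
  have h5 := e 0 2 1 1 (by decide)
  have h6 := e 0 0 2 1 (by decide)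
  have h7 := e 0 0 2 2 (by decide)
  have h8 := e 0 1 2 0 (by decide)
  have h9 := e 0 1 2 2 (by decide)
  have h10 := e 0 2 2 0 (by decide)
  have h11 := e 0 2 2 1 (by decide)
  have h12 := e 1 0 2 1 (by decide)
  have h13 := e 1 0 2 2 (by decide)
  have h14 := e 1 1 2 0 (by decide)
  have h15 := e 1 1 2 2 (by decide)
  have h16 := e 1 2 2 0 (by decide)
  have h17 := e 1 2 2 1 (by decide)
  have t0 := ht 0 1 (by decide)
  have t1 := ht 0 2 (by decide)
  have t2 := ht 1 2 (by decide)
  grind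

/-! ### Branch sets in an outerplanar drawing -/

lemma isPathConnected_compl_closedBall (R : ℝ) :
    IsPathConnected (Metric.closedBall (0 : ℂ) R)ᶜ := by
  by_cases hR : 0 ≤ R
  · have h : (Metric.closedBall (0 : ℂ) R)ᶜ =
        (fun x : ℝ × ℝ ↦ (x.1 * Complex.exp (x.2 * Complex.I) : ℂ)) ''
          (Set.Ioi R ×ˢ Set.univ) := by
      ext z
      simp only [Set.mem_compl_iff, Metric.mem_closedBall, dist_zero_right, not_le, Set.mem_image,
        Set.mem_prod, Set.mem_Ioi, Set.mem_univ, and_true, Prod.exists]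
      constructor
      · intro hz
        exact ⟨‖z‖, z.arg, hz, Complex.norm_mul_exp_arg_mul_I z⟩
      · rintro ⟨r, t, hr, rfl⟩
        rw [norm_mul, Complex.norm_exp_ofReal_mul_I, mul_one, Complex.norm_real]
        exact hr.trans_le (le_abs_self r)
    rw [h]
    exact (((convex_Ioi R).prod convex_univ).isPathConnected ⟨(R + 1, 0), by simp⟩).image
      (by fun_prop)
  · rw [Metric.closedBall_eq_empty.2 (not_le.1 hR), Set.compl_empty]
    exact isPathConnected_univ

namespace PlaneDrawing

variable {V : Type*} {G : SimpleGraph V} (D : PlaneDrawing G)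

/-- The part of the drawing that represents the subgraph induced on `S`. -/
def hull (S : Set V) : Set ℂ :=
  D.point '' S ∪ ⋃ e ∈ {e ∈ G.edgeSet | ∀ v ∈ e, v ∈ S}, D.arc e

lemma hull_univ : D.hull Set.univ = D.support := by
  simp [hull, support]

lemma hull_mono {S T : Set V} (h : S ⊆ T) : D.hull S ⊆ D.hull T :=
  Set.union_subset_union (Set.image_mono h)
    (Set.biUnion_mono (fun _ he ↦ ⟨he.1, fun v hv ↦ h (he.2 v hv)⟩) fun _ _ ↦ subset_rfl)

lemma point_mem_hull {S : Set V} {v : V} : D.point v ∈ D.hull S ↔ v ∈ S := by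
  refine ⟨?_, fun h ↦ Or.inl ⟨v, h, rfl⟩⟩
  rintro (⟨w, hw, h⟩ | h)
  · rwa [← D.point_injective h]
  · simp only [Set.mem_iUnion] at h
    obtain ⟨e, ⟨he, heS⟩, h⟩ := h
    exact heS v (D.point_mem_arc v e he h)

lemma disjoint_hull {S T : Set V} (h : Disjoint S T) : Disjoint (D.hull S) (D.hull T) := by
  refine Set.disjoint_left.2 fun x hS hT ↦ ?_
  rcases hS with ⟨v, hv, rfl⟩ | hS
  · exact Set.disjoint_left.1 h hv (D.point_mem_hull.1 hT)
  rcases hT with ⟨v, hv, rfl⟩ | hT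
  · exact Set.disjoint_left.1 h (D.point_mem_hull.1 (Or.inr hS)) hv
  simp only [Set.mem_iUnion] at hS hT
  obtain ⟨e, ⟨he, heS⟩, hxe⟩ := hS
  obtain ⟨f, ⟨hf, hfT⟩, hxf⟩ := hT
  by_cases hef : e = f
  · subst hef
    induction e with | _ u v =>
    exact Set.disjoint_left.1 h (heS u (by simp)) (hfT u (by simp))
  · obtain ⟨v, hve, hvf, -⟩ := D.arc_inter e he f hf hef x hxe hxf
    exact Set.disjoint_left.1 h (heS v hve) (hfT v hvf)

lemma isCompact_arc {e : Sym2 V} (he : e ∈ G.edgeSet) : IsCompact (D.arc e) := by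
  induction e with | _ u v =>
  obtain ⟨γ, -, hγ⟩ := D.isArc u v he
  rw [← hγ]
  exact isCompact_range γ.continuous

lemma isCompact_hull [Finite V] (S : Set V) : IsCompact (D.hull S) :=
  ((S.toFinite.image _).isCompact).union
    ((Set.toFinite _).isCompact_biUnion fun _ he ↦ D.isCompact_arc he.1)

lemma joinedIn_hull {u v : V} (p : G.Walk u v) {S : Set V} (hp : ∀ w ∈ p.support, w ∈ S) :
    JoinedIn (D.hull S) (D.point u) (D.point v) := by
  induction p with
  | nil => exact JoinedIn.refl (D.point_mem_hull.2 (hp _ (by simp)))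
  | @cons u v w h p ih =>
    refine JoinedIn.trans ?_ (ih fun x hx ↦ hp x (by simp [hx]))
    obtain ⟨γ, -, hγ⟩ := D.isArc u v h
    refine ⟨γ, fun t ↦ Or.inr (Set.mem_biUnion (x := s(u, v)) ⟨h, ?_⟩ (hγ ▸ ⟨t, rfl⟩))⟩
    intro x hx
    rcases Sym2.mem_iff.1 hx with rfl | rfl
    · exact hp _ (by simp)
    · exact hp _ (by simp)

/-- A point of the outer face from which every vertex on the boundary of the outer face can be
reached while avoiding the drawing of the graph without that vertex. The path stays in the outer
face until it is close to the vertex; only near its end may it meet edges at that vertex. -/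
lemma exists_apex [Finite V] : ∃ z ∉ D.support, ∀ v, D.point v ∈ frontier D.outerFace →
    JoinedIn (D.hull {v}ᶜ)ᶜ z (D.point v) := by
  have hc : IsCompact D.support := D.hull_univ ▸ D.isCompact_hull Set.univ
  obtain ⟨R, hR⟩ := hc.isBounded.subset_closedBall 0
  have hfar := isPathConnected_compl_closedBall R
  obtain ⟨z, hz⟩ := hfar.nonempty
  have hsub : (Metric.closedBall (0 : ℂ) R)ᶜ ⊆ D.supportᶜ := Set.compl_subset_compl.2 hR
  have hopen : IsOpen (D.supportᶜ) := hc.isClosed.isOpen_compl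
  have hreach : ∀ x ∈ D.outerFace, JoinedIn D.supportᶜ z x := by
    rintro x ⟨hx, hxb⟩
    obtain ⟨y, hy, hyR⟩ : ∃ y ∈ connectedComponentIn D.supportᶜ x,
        y ∉ Metric.closedBall (0 : ℂ) R := by
      by_contra! h
      exact hxb (Metric.isBounded_closedBall.subset h)
    have hcomp : IsPathConnected (connectedComponentIn D.supportᶜ x) :=
      (hopen.connectedComponentIn.isConnected_iff_isPathConnected).1
        (isConnected_connectedComponentIn_iff.2 hx)
    exact ((hfar.joinedIn z hz y hyR).mono hsub).trans
      ((hcomp.joinedIn y hy x (mem_connectedComponentIn hx)).mono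
        (connectedComponentIn_subset _ _))
  refine ⟨z, hsub hz, fun v hv ↦ ?_⟩
  have hK : IsOpen (D.hull {v}ᶜ)ᶜ := (D.isCompact_hull _).isClosed.isOpen_compl
  have hvK : D.point v ∈ (D.hull {v}ᶜ)ᶜ := fun h ↦ D.point_mem_hull.1 h rfl
  obtain ⟨ε, hε, hball⟩ := Metric.isOpen_iff.1 hK _ hvK
  obtain ⟨x, hx, hvx⟩ := Metric.mem_closure_iff.1 (frontier_subset_closure hv) ε hε
  refine ((hreach x hx).mono ?_).trans
    (JoinedIn.mono (U := Metric.ball (D.point v) ε) ?_ hball)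
  · exact Set.compl_subset_compl.2 (D.hull_univ ▸ D.hull_mono (Set.subset_univ _))
  · exact ((convex_ball _ _).isPathConnected ⟨_, Metric.mem_ball_self hε⟩).joinedIn _
      (by rwa [Metric.mem_ball, dist_comm]) _ (Metric.mem_ball_self hε)

end PlaneDrawing

/-- An outerplanar graph has no subdivision of `K₄`, even in the weak sense that only the branch
walks without a common end have to be disjoint. Joining the branch vertices to a point of the
outer face would draw `K₅`. -/
theorem IsOuterplanar.not_completeGraph_four {V : Type*} [Finite V] {G : SimpleGraph V}
    (hG : IsOuterplanar G) (x : Fin 4 → V) (hx : Function.Injective x) (S : Fin 4 → Fin 4 → Set V)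
    (hS : ∀ i j, i < j → ∃ p : G.Walk (x i) (x j), ∀ v ∈ p.support, v ∈ S i j)
    (hd : ∀ i j k l, i < j → k < l → i ≠ k → i ≠ l → j ≠ k → j ≠ l → Disjoint (S i j) (S k l))
    (hb : ∀ i j k, i < j → k ≠ i → k ≠ j → x k ∉ S i j) : False := by
  obtain ⟨D, hD⟩ := hG
  obtain ⟨z, hz, hzD⟩ := D.exists_apex
  have hzp : ∀ v, z ≠ D.point v := fun v h ↦ hz (Or.inl ⟨v, h.symm⟩)
  have hapex : ∀ i j k, i < j → k ≠ i → k ≠ j →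
      Disjoint (D.hull (S i j)) (D.hull {x k}ᶜ)ᶜ := fun i j k h1 h2 h3 ↦
    Set.disjoint_compl_right_iff_subset.2
      (D.hull_mono (Set.subset_compl_singleton_iff.2 (hb i j k h1 h2 h3)))
  refine not_drawing_completeGraph_five (Fin.snoc (α := fun _ ↦ ℂ) (D.point ∘ x) z) ?_
    (fun i j ↦ Fin.lastCases (motive := fun _ ↦ Set ℂ) Set.univ
      (fun i ↦ Fin.lastCases (motive := fun _ ↦ Set ℂ) (D.hull {x i}ᶜ)ᶜ
        (fun j ↦ D.hull (S i j)) j) i) ?_ ?_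
  · intro i j
    induction i using Fin.lastCases <;> induction j using Fin.lastCases <;>
      simp [-Fin.reduceLast, hzp, (hzp _).symm, D.point_injective.eq_iff, hx.eq_iff]
  · intro i j hij
    induction i using Fin.lastCases with
    | last => exact absurd (Fin.le_last j) hij.not_ge
    | cast i =>
      induction j using Fin.lastCases with
      | last => simpa [-Fin.reduceLast] using (hzD (x i) (hD _)).symm
      | cast j =>
        obtain ⟨p, hp⟩ := hS i j (by simpa using hij)
        simpa using D.joinedIn_hull p hp
  · intro i j k l hij hkl
    induction i using Fin.lastCases with
    | last => exact absurd (Fin.le_last j) hij.not_ge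
    | cast i =>
      induction k using Fin.lastCases with
      | last => exact absurd (Fin.le_last l) hkl.not_ge
      | cast k =>
        induction j using Fin.lastCases with
        | last =>
          induction l using Fin.lastCases with
          | last => intros; contradiction
          | cast l =>
            intro h1 h2 _ _
            simp only [Fin.lastCases_castSucc, Fin.lastCases_last]
            exact (hapex k l i (by simpa using hkl) (by simpa using h1) (by simpa using h2)).symm
        | cast j =>
          induction l using Fin.lastCases with
          | last =>
            intro h1 _ h2 _
            simp only [Fin.lastCases_castSucc, Fin.lastCases_last]
            exact hapex i j k (by simpa using hij) (by simpa using h1.symm) (by simpa using h2.symm)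
          | cast l =>
            intro h1 h2 h3 h4
            simp only [Fin.lastCases_castSucc]
            exact D.disjoint_hull (hd i j k l (by simpa using hij) (by simpa using hkl)
              (by simpa using h1) (by simpa using h2) (by simpa using h3) (by simpa using h4))

/-- An outerplanar graph has no subdivision of `K₂,₃`, even in the weak sense that only the branch
walks without a common end have to be disjoint. Joining the three branch vertices of the larger
side to a point of the outer face would draw `K₃,₃`. -/
theorem IsOuterplanar.not_completeBipartite_two_three {V : Type*} [Finite V] {G : SimpleGraph V}
    (hG : IsOuterplanar G) (a : Fin 2 → V) (x : Fin 3 → V)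
    (hax : Function.Injective (Sum.elim a x)) (S : Fin 2 → Fin 3 → Set V)
    (hS : ∀ i j, ∃ p : G.Walk (a i) (x j), ∀ v ∈ p.support, v ∈ S i j)
    (hd : ∀ j l, j ≠ l → Disjoint (S 0 j) (S 1 l))
    (hb : ∀ i j k, k ≠ j → x k ∉ S i j) : False := by
  obtain ⟨D, hD⟩ := hG
  obtain ⟨z, hz, hzD⟩ := D.exists_apex
  have hzp : ∀ v, z ≠ D.point v := fun v h ↦ hz (Or.inl ⟨v, h.symm⟩)
  have ha : Function.Injective a := hax.comp Sum.inl_injective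
  have hx : Function.Injective x := hax.comp Sum.inr_injective
  have hne : ∀ i j, a i ≠ x j := fun i j h ↦ Sum.inl_ne_inr (hax h)
  have hd' : ∀ i k j l, i ≠ k → j ≠ l → Disjoint (S i j) (S k l) := by
    intro i k j l hik hjl
    match i, k with
    | 0, 0 => contradiction
    | 1, 1 => contradiction
    | 0, 1 => exact hd j l hjl
    | 1, 0 => exact (hd l j hjl.symm).symm
  have hapex : ∀ i j k, k ≠ j → Disjoint (D.hull (S i j)) (D.hull {x k}ᶜ)ᶜ := fun i j k h ↦
    Set.disjoint_compl_right_iff_subset.2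
      (D.hull_mono (Set.subset_compl_singleton_iff.2 (hb i j k h)))
  refine not_drawing_completeBipartite_three (Fin.snoc (α := fun _ ↦ ℂ) (D.point ∘ a) z)
    (D.point ∘ x) ?_
    (fun i j ↦ Fin.lastCases (motive := fun _ ↦ Set ℂ) (D.hull {x j}ᶜ)ᶜ
      (fun i ↦ D.hull (S i j)) i) ?_ ?_
  · refine Function.Injective.sumElim ?_ (D.point_injective.comp hx) ?_
    · intro i j
      induction i using Fin.lastCases <;> induction j using Fin.lastCases <;>
        simp [-Fin.reduceLast, hzp, (hzp _).symm, D.point_injective.eq_iff, ha.eq_iff]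
    · intro i j
      induction i using Fin.lastCases <;>
        simp [-Fin.reduceLast, hzp, D.point_injective.eq_iff, hne]
  · intro i j
    induction i using Fin.lastCases with
    | last => simpa [-Fin.reduceLast] using hzD (x j) (hD _)
    | cast i =>
      obtain ⟨p, hp⟩ := hS i j
      simpa using D.joinedIn_hull p hp
  · intro i j k l hik hjl
    induction i using Fin.lastCases with
    | last =>
      induction k using Fin.lastCases with
      | last => contradiction
      | cast k => simpa [-Fin.reduceLast] using (hapex k l j hjl).symm
    | cast i =>
      induction k using Fin.lastCases with
      | last => simpa [-Fin.reduceLast] using hapex i j l hjl.symm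
      | cast k => simpa using D.disjoint_hull (hd' i k j l (by simpa using hik) hjl)

/-! ### Cyclic labelings -/

/-- A cycle of length `n` in `G`, as an `n`-periodic labeling of its vertices by the natural
numbers. The value `n = 2` is allowed; it describes a single edge traversed back and forth. -/
structure IsCyclicLabeling {V : Type*} (G : SimpleGraph V) (n : ℕ) (f : ℕ → V) : Prop where
  eq_iff : ∀ i j, f i = f j ↔ i ≡ j [MOD n]
  adj : ∀ i, G.Adj (f i) (f (i + 1))

namespace IsCyclicLabeling

variable {V : Type*} {G : SimpleGraph V} {n : ℕ} {f : ℕ → V}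

lemma add_self (hf : IsCyclicLabeling G n f) (i : ℕ) : f (i + n) = f i :=
  (hf.eq_iff _ _).2 (by simp [Nat.ModEq])

lemma ne (hf : IsCyclicLabeling G n f) {i j : ℕ} (hij : i < j) (hji : j < i + n) : f i ≠ f j := by
  intro h
  have := (Nat.modEq_iff_dvd' hij.le).1 ((hf.eq_iff i j).1 h)
  exact absurd (Nat.eq_zero_of_dvd_of_lt this (by omega)) (by omega)

lemma eq_of_lt (hf : IsCyclicLabeling G n f) {i j : ℕ} (hij : i < j + n) (hji : j < i + n)
    (h : f i = f j) : i = j := by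
  rcases lt_trichotomy i j with h' | h' | h'
  · exact absurd h (hf.ne h' hji)
  · exact h'
  · exact absurd h.symm (hf.ne h' hij)

lemma two_le (hf : IsCyclicLabeling G n f) (hn : n ≠ 0) : 2 ≤ n := by
  by_contra h
  obtain rfl : n = 1 := by omega
  exact (hf.adj 0).ne ((hf.eq_iff _ _).2 (Nat.modEq_one))

lemma shift (hf : IsCyclicLabeling G n f) (c : ℕ) : IsCyclicLabeling G n fun i ↦ f (i + c) where
  eq_iff i j := by rw [hf.eq_iff]; exact ⟨Nat.ModEq.add_right_cancel' c, fun h ↦ h.add_right c⟩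
  adj i := by simpa [add_right_comm] using hf.adj (i + c)

/-- Multiplication by `n - 1` reverses the direction of a labeling of period `n`. -/
lemma reverse (hf : IsCyclicLabeling G n f) (hn : n ≠ 0) :
    IsCyclicLabeling G n fun i ↦ f ((n - 1) * i) where
  eq_iff i j := by
    rw [hf.eq_iff]
    refine ⟨Nat.ModEq.cancel_left_of_coprime ?_, Nat.ModEq.mul_left _⟩
    exact (Nat.coprime_self_sub_right (by omega)).2 (by simp)
  adj i := by
    have h1 := hf.adj ((n - 1) * i + (n - 1))
    have h2 : (n - 1) * i + (n - 1) + 1 = (n - 1) * i + n := by omega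
    rw [h2, hf.add_self] at h1
    rw [mul_add, mul_one]
    exact h1.symm

lemma exists_lt (hf : IsCyclicLabeling G n f) (hn : n ≠ 0) (i : ℕ) : ∃ j < n, f j = f i :=
  ⟨i % n, Nat.mod_lt _ (by omega), (hf.eq_iff _ _).2 (Nat.mod_modEq _ _)⟩

lemma le_card [Fintype V] (hf : IsCyclicLabeling G n f) : n ≤ Fintype.card V := by
  have : Function.Injective fun i : Fin n ↦ f i := fun i j h ↦
    Fin.ext (hf.eq_of_lt (by omega) (by omega) h)
  simpa using Fintype.card_le_of_injective _ this

lemma exists_walk (hf : IsCyclicLabeling G n f) {i j : ℕ} (hij : i ≤ j) :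
    ∃ p : G.Walk (f i) (f j), ∀ v ∈ p.support, v ∈ f '' Set.Icc i j := by
  induction j, hij using Nat.le_induction with
  | base => exact ⟨.nil, by simp⟩
  | succ j hij ih =>
    obtain ⟨p, hp⟩ := ih
    refine ⟨p.concat (hf.adj j), fun v hv ↦ ?_⟩
    rw [SimpleGraph.Walk.support_concat, List.mem_append] at hv
    rcases hv with hv | hv
    · exact Set.image_mono (Set.Icc_subset_Icc_right (by omega)) (hp v hv)
    · rw [List.mem_singleton.1 hv]
      exact ⟨j + 1, ⟨by omega, le_rfl⟩, rfl⟩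

lemma disjoint_image (hf : IsCyclicLabeling G n f) {S T : Set ℕ}
    (h : ∀ s ∈ S, ∀ t ∈ T, s ≠ t ∧ s < t + n ∧ t < s + n) : Disjoint (f '' S) (f '' T) := by
  rw [Set.disjoint_left]
  rintro _ ⟨s, hs, rfl⟩ ⟨t, ht, hst⟩
  obtain ⟨h1, h2, h3⟩ := h s hs t ht
  exact h1 (hf.eq_of_lt h2 h3 hst.symm)

lemma notMem_image (hf : IsCyclicLabeling G n f) {t : ℕ} {S : Set ℕ}
    (h : ∀ s ∈ S, s ≠ t ∧ s < t + n ∧ t < s + n) : f t ∉ f '' S := by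
  rintro ⟨s, hs, hst⟩
  obtain ⟨h1, h2, h3⟩ := h s hs
  exact h1 (hf.eq_of_lt h2 h3 hst)

/-- The chords of a cycle in an outerplanar graph do not cross. -/
theorem not_crossing [Finite V] (hf : IsCyclicLabeling G n f) (hG : IsOuterplanar G) {i j k l : ℕ}
    (hij : i < j) (hjk : j < k) (hkl : k < l) (hli : l < i + n) (h1 : G.Adj (f i) (f k))
    (h2 : G.Adj (f j) (f l)) : False := by
  refine hG.not_completeGraph_four ![f i, f j, f k, f l] ?_
    (fun a b ↦ f '' (![![∅, Set.Icc i j, {i, k}, Set.Icc l (i + n)], ![∅, ∅, Set.Icc j k, {j, l}],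
      ![∅, ∅, ∅, Set.Icc k l], ![∅, ∅, ∅, ∅]] a b)) ?_ ?_ ?_
  · have e1 := hf.ne (i := i) (j := j) (by omega) (by omega)
    have e2 := hf.ne (i := i) (j := k) (by omega) (by omega)
    have e3 := hf.ne (i := i) (j := l) (by omega) (by omega)
    have e4 := hf.ne (i := j) (j := k) (by omega) (by omega)
    have e5 := hf.ne (i := j) (j := l) (by omega) (by omega)
    have e6 := hf.ne (i := k) (j := l) (by omega) (by omega)
    simp only [Function.Injective, Fin.forall_fin_succ]
    simp [e1, e2, e3, e4, e5, e6, e1.symm, e2.symm, e3.symm, e4.symm, e5.symm, e6.symm]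
  · have w1 := hf.exists_walk hij.le
    have w2 := hf.exists_walk hjk.le
    have w3 := hf.exists_walk hkl.le
    have w4 : ∃ p : G.Walk (f i) (f l), ∀ v ∈ p.support, v ∈ f '' Set.Icc l (i + n) := by
      obtain ⟨p, hp⟩ := hf.exists_walk hli.le
      exact ⟨p.reverse.copy (hf.add_self i) rfl, by simpa using hp⟩
    have w5 : ∃ p : G.Walk (f i) (f k), ∀ v ∈ p.support, v ∈ f '' {i, k} :=
      ⟨h1.toWalk, by simp⟩
    have w6 : ∃ p : G.Walk (f j) (f l), ∀ v ∈ p.support, v ∈ f '' {j, l} :=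
      ⟨h2.toWalk, by simp⟩
    intro a b hab
    fin_cases a <;> fin_cases b <;> first | exact absurd hab (by decide) | assumption
  · intro a b c d h1 h2 h3 h4 h5 h6
    fin_cases a <;> fin_cases b <;> first | exact absurd h1 (by decide) | skip
    all_goals fin_cases c <;> fin_cases d <;> first
      | exact absurd h2 (by decide) | exact absurd rfl h3 | exact absurd rfl h4
      | exact absurd rfl h5 | exact absurd rfl h6
      | (refine hf.disjoint_image fun s hs t ht ↦ ?_; simp at hs ht; omega)
  · intro a b c h1 h2 h3
    fin_cases a <;> fin_cases b <;> first | exact absurd h1 (by decide) | skip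
    all_goals fin_cases c <;> first
      | exact absurd rfl h2 | exact absurd rfl h3
      | (refine hf.notMem_image fun s hs ↦ ?_; simp at hs; omega)

/-- A finite sequence that closes up gives a cyclic labeling. -/
lemma of_injOn {N : ℕ} (hN : N ≠ 0) (h : ℕ → V) (hinj : ∀ i < N, ∀ j < N, h i = h j → i = j)
    (hadj : ∀ i, i + 1 < N → G.Adj (h i) (h (i + 1))) (hclose : G.Adj (h (N - 1)) (h 0)) :
    IsCyclicLabeling G N fun i ↦ h (i % N) where
  eq_iff i j := ⟨fun e ↦ hinj _ (Nat.mod_lt _ (by omega)) _ (Nat.mod_lt _ (by omega)) e,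
    fun e ↦ congrArg h e⟩
  adj i := by
    have hi := Nat.mod_lt i (Nat.pos_of_ne_zero hN)
    rcases Nat.lt_or_ge (i % N + 1) N with h' | h'
    · have := hadj _ h'
      rwa [← Nat.mod_add_mod, Nat.mod_eq_of_lt h']
    · have e : i % N = N - 1 := by omega
      have : (i + 1) % N = 0 := by
        rw [← Nat.mod_add_mod, e, Nat.sub_add_cancel (by omega), Nat.mod_self]
      rw [this, e]
      exact hclose

/-- An ear whose two ends are neighbours on the cycle lengthens the cycle. -/
lemma exists_longer (hf : IsCyclicLabeling G n f) (hn : n ≠ 0) {z : V} (hz : G.Adj (f 0) z)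
    (w : G.Walk z (f 1)) (hw : w.IsPath) (hzf : z ∉ Set.range f)
    (hwf : ∀ x ∈ w.support, x ∈ Set.range f → x = f 1) :
    ∃ N > n, ∃ g, IsCyclicLabeling G N g := by
  have hm : w.length ≠ 0 := fun h ↦ hzf ⟨1, (SimpleGraph.Walk.eq_of_length_eq_zero h).symm⟩
  have hcross : ∀ s < w.length, w.getVert s ∉ Set.range f := by
    intro s hs hsf
    have h1 := (hwf _ (w.getVert_mem_support s) hsf).trans w.getVert_length.symm
    exact hs.ne (hw.getVert_injOn (by simpa using hs.le) (by simp) h1)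
  refine ⟨n + w.length, by omega, _, of_injOn (by omega)
    (fun t ↦ if t < n then f (1 + t) else w.getVert (t - n)) ?_ ?_ ?_⟩
  · intro i hi j hj h
    split_ifs at h with h1 h2 h2
    · have := hf.eq_of_lt (by omega) (by omega) h
      omega
    · exact absurd ⟨_, h⟩ (hcross (j - n) (by omega))
    · exact absurd ⟨_, h.symm⟩ (hcross (i - n) (by omega))
    · have := hw.getVert_injOn (by simp; omega) (by simp; omega) h
      omega
  · intro i hi
    split_ifs with h1 h2 h2
    · exact hf.adj (1 + i)
    · obtain rfl : n = i + 1 := by omega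
      rw [Nat.sub_self, w.getVert_zero, add_comm, show f (i + 1) = f 0 from ?_]
      · exact hz
      · simpa using hf.add_self 0
    · omega
    · rw [show i + 1 - n = i - n + 1 by omega]
      exact w.adj_getVert_succ (by omega)
  · rw [if_neg (by omega), if_pos (by omega)]
    have := w.adj_getVert_succ (i := w.length - 1) (by omega)
    rw [show w.length - 1 + 1 = w.length by omega, w.getVert_length] at this
    rwa [show n + w.length - 1 - n = w.length - 1 by omega]

/-- A cycle with an ear between two vertices that are not neighbours on the cycle contains a
subdivision of `K₂,₃`. -/
lemma not_ear [Finite V] (hf : IsCyclicLabeling G n f) (hG : IsOuterplanar G) {z : V} {j : ℕ}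
    (hj : 2 ≤ j) (hjn : j + 2 ≤ n) (hz : G.Adj (f 0) z) (w : G.Walk z (f j))
    (hzf : z ∉ Set.range f) (hwf : ∀ x ∈ w.support, x ∈ Set.range f → x = f j) : False := by
  have hzi : ∀ i, f i ≠ z := fun i h ↦ hzf ⟨i, h⟩
  have hwi : ∀ i, i ≠ j → i < j + n → j < i + n → f i ∉ w.support := fun i h1 h2 h3 h ↦
    h1 (hf.eq_of_lt h2 h3 (hwf _ h ⟨i, rfl⟩))
  have hn0 : f n = f 0 := by simpa using hf.add_self 0
  refine hG.not_completeBipartite_two_three ![f n, f j] ![f 1, f (n - 1), z] ?_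
    ![![f '' {0, 1}, f '' {n, n - 1}, {f n, z}],
      ![f '' Set.Icc 1 j, f '' Set.Icc j (n - 1), {v | v ∈ w.support}]] ?_ ?_ ?_
  · have e1 := hf.ne (i := j) (j := n) (by omega) (by omega)
    have e2 := hf.ne (i := 1) (j := n) (by omega) (by omega)
    have e3 := hf.ne (i := n - 1) (j := n) (by omega) (by omega)
    have e4 := hf.ne (i := 1) (j := j) (by omega) (by omega)
    have e5 := hf.ne (i := j) (j := n - 1) (by omega) (by omega)
    have e6 := hf.ne (i := 1) (j := n - 1) (by omega) (by omega)
    simp only [Function.Injective, Sum.forall, Fin.forall_fin_succ]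
    simp [e1, e2, e3, e4, e5, e6, e1.symm, e2.symm, e3.symm, e4.symm, e5.symm, e6.symm, hzi,
      (hzi _).symm]
  · have w1 : ∃ p : G.Walk (f n) (f 1), ∀ v ∈ p.support, v ∈ f '' {0, 1} := by
      rw [hn0]
      exact ⟨(hf.adj 0).toWalk, by simp⟩
    have w2 : ∃ p : G.Walk (f n) (f (n - 1)), ∀ v ∈ p.support, v ∈ f '' {n, n - 1} := by
      have := hf.adj (n - 1)
      rw [Nat.sub_add_cancel (by omega)] at this
      exact ⟨this.symm.toWalk, by simp⟩
    have w3 : ∃ p : G.Walk (f n) z, ∀ v ∈ p.support, v ∈ ({f n, z} : Set V) := by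
      rw [hn0]
      exact ⟨hz.toWalk, by simp⟩
    have w4 : ∃ p : G.Walk (f j) (f 1), ∀ v ∈ p.support, v ∈ f '' Set.Icc 1 j := by
      obtain ⟨p, hp⟩ := hf.exists_walk (show 1 ≤ j by omega)
      exact ⟨p.reverse, by simpa using hp⟩
    have w5 := hf.exists_walk (show j ≤ n - 1 by omega)
    have w6 : ∃ p : G.Walk (f j) z, ∀ v ∈ p.support, v ∈ {v | v ∈ w.support} :=
      ⟨w.reverse, by simp⟩
    intro a b
    fin_cases a <;> fin_cases b <;> assumption
  · have hzS : ∀ S, Disjoint {f n, z} (f '' S) ↔ f n ∉ f '' S := fun S ↦ by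
      simp [Set.disjoint_insert_left, hzi]
    have hwS : ∀ a b, Disjoint (f '' {a, b}) {v | v ∈ w.support} ↔
        f a ∉ w.support ∧ f b ∉ w.support := fun a b ↦ by
      simp [Set.image_pair, Set.disjoint_insert_left]
    intro a b hab
    fin_cases a <;> fin_cases b <;> first
      | exact absurd rfl hab
      | (refine hf.disjoint_image fun s hs t ht ↦ ?_; simp at hs ht; omega)
      | (refine (hwS _ _).2 ⟨?_, ?_⟩ <;> apply hwi <;> omega)
      | (refine (hzS _).2 (hf.notMem_image fun s hs ↦ ?_); simp at hs; omega)
  · intro a b c hbc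
    fin_cases a <;> fin_cases b <;> fin_cases c <;> first
      | exact absurd rfl hbc
      | (refine hf.notMem_image fun s hs ↦ ?_; simp at hs; omega)
      | (apply hwi <;> omega)
      | (rintro ⟨s, -, hs⟩; exact hzi s hs)
      | (rintro (h | h)
         · exact hf.ne (i := 1) (j := n) (by omega) (by omega) h
         · exact hzi _ h)
      | (rintro (h | h)
         · exact hf.ne (i := n - 1) (j := n) (by omega) (by omega) h
         · exact hzi _ h)

end IsCyclicLabeling

/-! ### Hamiltonian cycles -/

/-- A walk that ends in `S` has an initial part up to its first vertex in `S`. -/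
lemma exists_walk_first {V : Type*} {G : SimpleGraph V} {S : Set V} {u v : V} (p : G.Walk u v)
    (hv : v ∈ S) : ∃ b ∈ S, ∃ q : G.Walk u b, (∀ x ∈ q.support, x ∈ p.support) ∧
      ∀ x ∈ q.support, x ∈ S → x = b := by
  induction p with
  | @nil u => exact ⟨u, hv, .nil, by simp⟩
  | @cons u w _ h p ih =>
    by_cases hu : u ∈ S
    · exact ⟨u, hu, .nil, by simp⟩
    · obtain ⟨b, hb, q, hq, hqS⟩ := ih hv
      refine ⟨b, hb, .cons h q, ?_, ?_⟩
      · intro x hx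
        rw [SimpleGraph.Walk.support_cons, List.mem_cons] at hx ⊢
        exact hx.imp_right (hq x)
      · intro x hx hxS
        rw [SimpleGraph.Walk.support_cons, List.mem_cons] at hx
        rcases hx with rfl | hx
        · exact absurd hxS hu
        · exact hqS x hx hxS

lemma exists_walk_of_induce {V : Type*} {G : SimpleGraph V} {S : Set V} {a b : S}
    (q : (G.induce S).Walk a b) : ∃ p : G.Walk (a : V) (b : V), ∀ x ∈ p.support, x ∈ S := by
  induction q with
  | @nil a => exact ⟨.nil, by simp⟩
  | @cons a b _ h q ih =>
    obtain ⟨p, hp⟩ := ih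
    refine ⟨.cons (SimpleGraph.induce_adj.1 h) p, fun x hx ↦ ?_⟩
    rw [SimpleGraph.Walk.support_cons, List.mem_cons] at hx
    rcases hx with rfl | hx
    · exact a.2
    · exact hp x hx

/-- In an outerplanar graph, a cycle through `f 0` that misses a neighbour of `f 0` is not a longest
cycle, provided that `f 0` is no cut-vertex. -/
lemma IsCyclicLabeling.exists_longer_of_adj {V : Type*} [Finite V] {G : SimpleGraph V}
    {n : ℕ} {f : ℕ → V} (hf : IsCyclicLabeling G n f) (hn : n ≠ 0) (hout : IsOuterplanar G)
    (hcut : (G.induce ({f 0}ᶜ : Set V)).Connected) {z : V} (hz : G.Adj (f 0) z)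
    (hzf : z ∉ Set.range f) : ∃ N > n, ∃ g, IsCyclicLabeling G N g := by
  classical
  have h2 := hf.two_le hn
  obtain ⟨q⟩ := hcut.preconnected ⟨z, hz.ne'⟩ ⟨f 1, (hf.adj 0).ne'⟩
  obtain ⟨p, hpS⟩ := exists_walk_of_induce q
  have hp : f 0 ∉ p.support := fun h ↦ hpS _ h rfl
  -- The first vertex on the cycle of a walk from `z` to `f 1` that avoids `f 0` ends an ear.
  obtain ⟨b, ⟨j', hj'⟩, w', hw', hwf⟩ := exists_walk_first (S := Set.range f) p ⟨1, rfl⟩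
  obtain ⟨j, hjn, hj⟩ := hf.exists_lt hn j'
  obtain rfl : f j = b := hj.trans hj'
  have hw : ∀ x ∈ w'.bypass.support, x ∈ Set.range f → x = f j := fun x hx ↦
    hwf x (w'.support_bypass_subset_support hx)
  have hj0 : j ≠ 0 := by
    rintro rfl
    exact hp (hw' _ w'.end_mem_support)
  have hwp := w'.bypass_isPath
  generalize w'.bypass = w at hw hwp
  rcases eq_or_ne j 1 with rfl | hj1
  · exact hf.exists_longer hn hz w hwp hzf hw
  rcases eq_or_ne j (n - 1) with rfl | hj2
  · have hran : Set.range (fun i ↦ f ((n - 1) * i)) ⊆ Set.range f := by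
      rintro _ ⟨i, rfl⟩; exact ⟨(n - 1) * i, rfl⟩
    refine (hf.reverse hn).exists_longer hn (z := z) (by simpa using hz)
      (w.copy rfl (by simp)) (by simpa using hwp) (fun h ↦ hzf (hran h)) ?_
    intro x hx hxr
    simpa using hw x (by simpa using hx) (hran hxr)
  · exact (hf.not_ear hout (by omega) (by omega) hz w hzf hw).elim

/-- A longest cycle of a 2-connected outerplanar graph passes through every vertex. -/
lemma IsCyclicLabeling.exists_longer_of_not_surjective {V : Type*} [Fintype V] {G : SimpleGraph V}
    {n : ℕ} {f : ℕ → V} (hf : IsCyclicLabeling G n f) (hn : n ≠ 0) (hout : IsOuterplanar G)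
    (hconn : IsTwoConnected G) (hs : ¬ Function.Surjective f) :
    ∃ N > n, ∃ g, IsCyclicLabeling G N g := by
  obtain ⟨-, hG, hcut⟩ := hconn
  simp only [Function.Surjective, not_forall] at hs
  obtain ⟨y, hy⟩ := hs
  obtain ⟨p⟩ := hG.preconnected (f 0) y
  obtain ⟨d, -, ⟨c, hc⟩, hz⟩ := p.exists_boundary_dart (Set.range f) ⟨0, rfl⟩ hy
  refine (hf.shift c).exists_longer_of_adj hn hout (hcut _) (z := d.snd) ?_ ?_
  · simp [hc]
  · rintro ⟨i, hi⟩
    exact hz ⟨i + c, hi⟩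

/-- A 2-connected outerplanar graph has a Hamiltonian cycle. -/
theorem exists_hamiltonian_labeling {V : Type*} [Fintype V] {G : SimpleGraph V}
    (hout : IsOuterplanar G) (hconn : IsTwoConnected G) :
    ∃ n ≥ 3, ∃ f : ℕ → V, IsCyclicLabeling G n f ∧ Function.Surjective f := by
  obtain ⟨hcard, hG, -⟩ := id hconn
  have : Nontrivial V := Fintype.one_lt_card_iff_nontrivial.1 (by omega)
  obtain ⟨u⟩ := hG.nonempty
  obtain ⟨v, huv⟩ := hG.preconnected.exists_adj_of_nontrivial u
  set P : Set ℕ := {n | n ≠ 0 ∧ ∃ f : ℕ → V, IsCyclicLabeling G n f}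
  have hne : P.Nonempty := by
    refine ⟨2, by norm_num, _, IsCyclicLabeling.of_injOn (by norm_num)
      (fun i ↦ if i = 0 then u else v) ?_ ?_ ?_⟩
    · intro i hi j hj h
      interval_cases i <;> interval_cases j <;> simp_all [huv.ne, huv.ne']
    · intro i hi
      obtain rfl : i = 0 := by omega
      simpa using huv
    · simpa using huv.symm
  have hbdd : BddAbove P := ⟨Fintype.card V, fun n ⟨_, f, hf⟩ ↦ hf.le_card⟩
  obtain ⟨hn, f, hf⟩ := Nat.sSup_mem hne hbdd
  have hsurj : Function.Surjective f := by
    by_contra hs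
    obtain ⟨N, hN, g, hg⟩ := hf.exists_longer_of_not_surjective hn hout hconn hs
    exact absurd (le_csSup hbdd (show N ∈ P from ⟨by omega, g, hg⟩)) (by omega)
  refine ⟨sSup P, ?_, f, hf, hsurj⟩
  have : Function.Surjective fun i : Fin (sSup P) ↦ f i := fun x ↦ by
    obtain ⟨i, rfl⟩ := hsurj x
    obtain ⟨j, hj, hji⟩ := hf.exists_lt hn i
    exact ⟨⟨j, hj⟩, hji⟩
  have := Fintype.card_le_of_surjective _ this
  rw [Fintype.card_fin] at this
  omega

/-! ### Minimal edge dominating sets -/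

section Minimal

variable {V W : Type*} {G : SimpleGraph V} {H : SimpleGraph W}

/-- An edge shares a vertex with itself, so the alternative `e ∈ F` is redundant. -/
lemma isEdgeDominating_iff {F : Finset (Sym2 V)} : IsEdgeDominating G F ↔
    (∀ e ∈ F, e ∈ G.edgeSet) ∧ ∀ e ∈ G.edgeSet, ∃ f ∈ F, ∃ v, v ∈ e ∧ v ∈ f := by
  refine and_congr_right fun _ ↦ forall₂_congr fun e _ ↦ or_iff_right_of_imp fun he ↦ ?_
  induction e with | _ u v => exact ⟨_, he, u, by simp⟩

/-- An edge dominating set is minimal if and only if each of its edges dominates some edge that no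
other one dominates. -/
lemma minimal_isEdgeDominating_iff {F : Finset (Sym2 V)} : Minimal (IsEdgeDominating G) F ↔
    IsEdgeDominating G F ∧ ∀ f ∈ F, ∃ e ∈ G.edgeSet, ∀ f' ∈ F, (∃ v, v ∈ e ∧ v ∈ f') → f' = f := by
  classical
  constructor
  · refine fun h ↦ ⟨h.prop, fun f hf ↦ ?_⟩
    by_contra! hcon
    have : IsEdgeDominating G (F.erase f) := isEdgeDominating_iff.2
      ⟨fun e he ↦ h.prop.1 e (Finset.mem_of_mem_erase he), fun e he ↦ by
        obtain ⟨f', hf', hv, hne⟩ := hcon e he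
        exact ⟨f', Finset.mem_erase.2 ⟨hne, hf'⟩, hv⟩⟩
    exact Finset.notMem_erase f F (h.le_of_le this (Finset.erase_subset _ _) hf)
  · rintro ⟨h, hp⟩
    refine ⟨h, fun F' hF' hle f hf ↦ ?_⟩
    obtain ⟨e, he, hef⟩ := hp f hf
    obtain ⟨f', hf', hv⟩ := (isEdgeDominating_iff.1 hF').2 e he
    rwa [← hef f' (hle hf') hv]

lemma minimal_isEdgeDominating_map (φ : G ≃g H) {F : Finset (Sym2 V)}
    (hF : Minimal (IsEdgeDominating G) F) :
    Minimal (IsEdgeDominating H) (F.map φ.toEquiv.toEmbedding.sym2Map) := by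
  have hedge : ∀ e, e.map φ ∈ H.edgeSet ↔ e ∈ G.edgeSet := fun e ↦ by
    induction e with | _ u v => exact φ.map_rel_iff
  have hsurj : ∀ e : Sym2 W, ∃ e' : Sym2 V, e'.map φ = e := fun e ↦
    ⟨e.map φ.symm, by rw [Sym2.map_map]; induction e; simp⟩
  have hshare : ∀ e f : Sym2 V, (∃ v, v ∈ e.map φ ∧ v ∈ f.map φ) ↔ ∃ v, v ∈ e ∧ v ∈ f := by
    intro e f
    simp only [Sym2.mem_map]
    constructor
    · rintro ⟨_, ⟨a, ha, rfl⟩, b, hb, hab⟩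
      rw [φ.injective hab] at hb
      exact ⟨a, ha, hb⟩
    · rintro ⟨v, hv, hv'⟩
      exact ⟨_, ⟨v, hv, rfl⟩, v, hv', rfl⟩
  have hmap : ∀ e : Sym2 V, φ.toEquiv.toEmbedding.sym2Map e = e.map φ := fun _ ↦ rfl
  rw [minimal_isEdgeDominating_iff, isEdgeDominating_iff] at hF ⊢
  obtain ⟨⟨h1, h2⟩, h3⟩ := hF
  simp only [Finset.forall_mem_map, hmap, hedge]
  refine ⟨⟨h1, fun e he ↦ ?_⟩, fun f hf ↦ ?_⟩
  · obtain ⟨e, rfl⟩ := hsurj e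
    obtain ⟨f, hf, hv⟩ := h2 e ((hedge e).1 he)
    exact ⟨_, Finset.mem_map_of_mem _ hf, (hshare e f).2 hv⟩
  · obtain ⟨e, he, hef⟩ := h3 f hf
    exact ⟨e.map φ, (hedge e).2 he, fun f' hf' hv ↦ by rw [hef f' hf' ((hshare e f').1 hv)]⟩

lemma IsWellEdgeDominated.of_iso (hG : IsWellEdgeDominated G) (φ : G ≃g H) :
    IsWellEdgeDominated H := fun F₁ F₂ h₁ h₂ ↦ by
  simpa using hG _ _ (minimal_isEdgeDominating_map φ.symm h₁)
    (minimal_isEdgeDominating_map φ.symm h₂)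

lemma IsEdgeDominating.exists_minimal {F : Finset (Sym2 V)} (hF : IsEdgeDominating G F) :
    ∃ F', Minimal (IsEdgeDominating G) F' ∧ F'.card ≤ F.card := by
  obtain ⟨F', hle, hF'⟩ := exists_minimal_le_of_wellFoundedLT (IsEdgeDominating G) F hF
  exact ⟨F', hF', Finset.card_le_card hle⟩

end Minimal

/-! ### Matchings along a Hamiltonian cycle -/

namespace IsCyclicLabeling

variable {V : Type*} {G : SimpleGraph V} {n : ℕ} {f : ℕ → V}

lemma surjective_shift (hf : IsCyclicLabeling G n f) (hn : n ≠ 0) (hs : Function.Surjective f)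
    (c : ℕ) : Function.Surjective fun i ↦ f (i + c) := by
  intro v
  obtain ⟨i, rfl⟩ := hs v
  refine ⟨i + (n - 1) * c, (hf.eq_iff _ _).2 ?_⟩
  rw [add_assoc, ← Nat.succ_mul, Nat.succ_eq_add_one, Nat.sub_add_cancel (by omega)]
  simp [Nat.ModEq]

lemma exists_labels (hf : IsCyclicLabeling G n f) (hn : n ≠ 0) (hs : Function.Surjective f)
    {e : Sym2 V} (he : e ∈ G.edgeSet) :
    ∃ u v, u < v ∧ v < n ∧ e = s(f u, f v) ∧ G.Adj (f u) (f v) := by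
  induction e with | _ x y =>
  obtain ⟨u', rfl⟩ := hs x
  obtain ⟨v', rfl⟩ := hs y
  obtain ⟨u, hu, hu'⟩ := hf.exists_lt hn u'
  obtain ⟨v, hv, hv'⟩ := hf.exists_lt hn v'
  rw [← hu', ← hv'] at he ⊢
  have he : G.Adj (f u) (f v) := he
  rcases lt_trichotomy u v with h | rfl | h
  · exact ⟨u, v, h, hv, rfl, he⟩
  · exact absurd rfl he.ne
  · exact ⟨v, u, h, hu, Sym2.eq_swap, he.symm⟩

/-- A set of pairwise disjoint edges of a Hamiltonian cycle, no two of whose uncovered vertices are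
adjacent, is a minimal edge dominating set. The set `I` holds the smaller labels of its edges. -/
lemma exists_minimal_of_matching (hf : IsCyclicLabeling G n f) (hn : n ≠ 0)
    (hs : Function.Surjective f) (I : Finset ℕ) (hI : ∀ i ∈ I, i + 1 < n)
    (hI' : ∀ i ∈ I, i + 1 ∉ I)
    (hU : ∀ u v, u < v → v < n → u ∉ I → v ∉ I → (∀ i ∈ I, i + 1 ≠ u ∧ i + 1 ≠ v) →
      ¬ G.Adj (f u) (f v)) :
    ∃ F, Minimal (IsEdgeDominating G) F ∧ F.card = I.card := by
  classical
  have hmem : ∀ i ∈ I, ∀ j < n, f j ∈ s(f i, f (i + 1)) → j = i ∨ j = i + 1 := by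
    intro i hi j hj h
    have := hI i hi
    rcases Sym2.mem_iff.1 h with h | h
    · exact Or.inl (hf.eq_of_lt (by omega) (by omega) h)
    · exact Or.inr (hf.eq_of_lt (by omega) (by omega) h)
  have hshare : ∀ i ∈ I, ∀ j ∈ I, (∃ v, v ∈ s(f i, f (i + 1)) ∧ v ∈ s(f j, f (j + 1))) → i = j := by
    rintro i hi j hj ⟨v, hv, hv'⟩
    have := hI i hi
    have := hI' i hi
    have := hI' j hj
    rcases Sym2.mem_iff.1 hv with rfl | rfl
    · rcases hmem j hj i (by omega) hv' with h | rfl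
      · exact h
      · contradiction
    · rcases hmem j hj (i + 1) (by omega) hv' with rfl | h
      · contradiction
      · omega
  refine ⟨I.image fun i ↦ s(f i, f (i + 1)), minimal_isEdgeDominating_iff.2 ⟨⟨?_, ?_⟩, ?_⟩, ?_⟩
  · intro e he
    obtain ⟨i, -, rfl⟩ := Finset.mem_image.1 he
    exact hf.adj i
  · intro e he
    refine Or.inr ?_
    by_contra! hcon
    have hcov : ∀ i ∈ I, f i ∉ e ∧ f (i + 1) ∉ e := fun i hi ↦
      ⟨fun h ↦ hcon _ (Finset.mem_image_of_mem _ hi) _ h (by simp),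
        fun h ↦ hcon _ (Finset.mem_image_of_mem _ hi) _ h (by simp)⟩
    obtain ⟨u, v, huv, hv, rfl, hadj⟩ := hf.exists_labels hn hs he
    refine hU u v huv hv (fun h ↦ (hcov u h).1 (by simp)) (fun h ↦ (hcov v h).1 (by simp)) ?_ hadj
    exact fun i hi ↦ ⟨fun h ↦ (hcov i hi).2 (by simp [h]), fun h ↦ (hcov i hi).2 (by simp [h])⟩
  · intro e he
    obtain ⟨i, hi, rfl⟩ := Finset.mem_image.1 he
    refine ⟨_, G.mem_edgeSet.2 (hf.adj i), fun e' he' hv ↦ ?_⟩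
    obtain ⟨j, hj, rfl⟩ := Finset.mem_image.1 he'
    rw [hshare i hi j hj hv]
  · refine Finset.card_image_of_injOn fun i hi j hj hij ↦ hshare i hi j hj ?_
    exact ⟨f i, by simp, hij ▸ by simp⟩

/-- In a well-edge-dominated graph with a Hamiltonian cycle of even length at least six, vertices at
distance three on the cycle are adjacent: otherwise a perfect matching could be replaced by a
maximal one that misses two vertices. -/
lemma adj_of_even (hf : IsCyclicLabeling G n f) (hs : Function.Surjective f)
    (hG : IsWellEdgeDominated G) (hn : Even n) (h6 : 6 ≤ n) : G.Adj (f 0) (f 3) := by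
  obtain ⟨m, rfl⟩ := hn
  by_contra hadj
  -- `{0, 2} ∪ J` gives a perfect matching, `{1} ∪ J` one that misses the labels `0` and `3`.
  set J := (Finset.range (m + m)).filter fun i ↦ i % 2 = 0 ∧ 4 ≤ i
  have hJ : ∀ i, i ∈ J ↔ i < m + m ∧ i % 2 = 0 ∧ 4 ≤ i := by simp [J]
  obtain ⟨F₁, h₁, c₁⟩ := hf.exists_minimal_of_matching (by omega) hs (insert 0 (insert 2 J))
    (by simp only [Finset.mem_insert, hJ]; omega) (by simp only [Finset.mem_insert, hJ]; omega)
    (by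
      intro u v huv hv hu hv' hi
      simp only [Finset.mem_insert, hJ] at hu hv' hi
      have := hi (u - 1)
      omega)
  obtain ⟨F₂, h₂, c₂⟩ := hf.exists_minimal_of_matching (by omega) hs (insert 1 J)
    (by simp only [Finset.mem_insert, hJ]; omega) (by simp only [Finset.mem_insert, hJ]; omega)
    (by
      intro u v huv hv hu hv' hi
      simp only [Finset.mem_insert, hJ] at hu hv' hi
      have := hi (u - 1)
      have := hi (v - 1)
      obtain rfl : u = 0 := by omega
      obtain rfl : v = 3 := by omega
      exact hadj)
  have := hG F₁ F₂ h₁ h₂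
  rw [c₁, c₂, Finset.card_insert_of_notMem (by simp [hJ]),
    Finset.card_insert_of_notMem (by simp [hJ]),
    Finset.card_insert_of_notMem (by simp [hJ])] at this
  omega

/-- In a well-edge-dominated graph with a Hamiltonian cycle of odd length at least nine, three
vertices at successive distances three on the cycle are not independent. -/
lemma adj_of_odd (hf : IsCyclicLabeling G n f) (hs : Function.Surjective f)
    (hG : IsWellEdgeDominated G) (hn : Odd n) (h9 : 9 ≤ n) :
    G.Adj (f 0) (f 3) ∨ G.Adj (f 3) (f 6) ∨ G.Adj (f 0) (f 6) := by
  obtain ⟨m, rfl⟩ := hn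
  by_contra! hadj
  -- `{1, 3, 5} ∪ J` gives a matching that misses only the label `0`, and `{1, 4} ∪ J` one that
  -- misses the labels `0`, `3` and `6`.
  set J := (Finset.range (2 * m)).filter fun i ↦ i % 2 = 1 ∧ 7 ≤ i
  have hJ : ∀ i, i ∈ J ↔ i < 2 * m ∧ i % 2 = 1 ∧ 7 ≤ i := by simp [J]
  obtain ⟨F₁, h₁, c₁⟩ := hf.exists_minimal_of_matching (by omega) hs
    (insert 1 (insert 3 (insert 5 J)))
    (by simp only [Finset.mem_insert, hJ]; omega) (by simp only [Finset.mem_insert, hJ]; omega)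
    (by
      intro u v huv hv hu hv' hi
      simp only [Finset.mem_insert, hJ] at hu hv' hi
      have := hi (v - 1)
      omega)
  obtain ⟨F₂, h₂, c₂⟩ := hf.exists_minimal_of_matching (by omega) hs (insert 1 (insert 4 J))
    (by simp only [Finset.mem_insert, hJ]; omega) (by simp only [Finset.mem_insert, hJ]; omega)
    (by
      intro u v huv hv hu hv' hi
      simp only [Finset.mem_insert, hJ] at hu hv' hi
      have := hi (u - 1)
      have := hi (v - 1)
      have hu : u = 0 ∨ u = 3 ∨ u = 6 := by omega
      have hv : v = 0 ∨ v = 3 ∨ v = 6 := by omega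
      obtain ⟨a1, a2, a3⟩ := hadj
      rcases hu with rfl | rfl | rfl <;> rcases hv with rfl | rfl | rfl <;>
        first | assumption | omega)
  have := hG F₁ F₂ h₁ h₂
  rw [c₁, c₂, Finset.card_insert_of_notMem (by simp [hJ]),
    Finset.card_insert_of_notMem (by simp [hJ]), Finset.card_insert_of_notMem (by simp [hJ]),
    Finset.card_insert_of_notMem (by simp [hJ]),
    Finset.card_insert_of_notMem (by simp [hJ])] at this
  omega

/-- Noncrossing chords cannot satisfy `adj_of_even` or `adj_of_odd` for all rotations of the cycle,
which leaves only short cycles. -/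
lemma length_le_seven [Finite V] (hf : IsCyclicLabeling G n f) (hs : Function.Surjective f)
    (hG : IsWellEdgeDominated G) (hout : IsOuterplanar G) (h3 : 3 ≤ n) :
    n = 3 ∨ n = 4 ∨ n = 5 ∨ n = 7 := by
  have hsh := hf.surjective_shift (by omega) hs
  by_contra hlen
  rcases Nat.even_or_odd n with hn | hn
  · have h6 : 6 ≤ n := by obtain ⟨m, rfl⟩ := hn; omega
    exact hf.not_crossing hout (i := 0) (j := 1) (k := 3) (l := 4) (by omega) (by omega) (by omega)
      (by omega) (hf.adj_of_even hs hG hn h6) ((hf.shift 1).adj_of_even (hsh 1) hG hn h6)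
  · have h9 : 9 ≤ n := by obtain ⟨m, rfl⟩ := hn; omega
    have h0 := hf.adj_of_odd hs hG hn h9
    have h1 : G.Adj (f 1) (f 4) ∨ G.Adj (f 4) (f 7) ∨ G.Adj (f 1) (f 7) :=
      (hf.shift 1).adj_of_odd (hsh 1) hG hn h9
    have h2 : G.Adj (f 2) (f 5) ∨ G.Adj (f 5) (f 8) ∨ G.Adj (f 2) (f 8) :=
      (hf.shift 2).adj_of_odd (hsh 2) hG hn h9
    have cr : ∀ {i j k l}, G.Adj (f i) (f k) → G.Adj (f j) (f l) →
        ¬ (i < j ∧ j < k ∧ k < l ∧ l < i + n) := fun h h' ⟨a, b, c, d⟩ ↦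
      hf.not_crossing hout a b c d h h'
    rcases h0 with h0 | h0 | h0 <;> rcases h1 with h1 | h1 | h1 <;> rcases h2 with h2 | h2 | h2 <;>
      first
      | exact cr h0 h1 (by omega) | exact cr h1 h0 (by omega) | exact cr h0 h2 (by omega)
      | exact cr h2 h0 (by omega) | exact cr h1 h2 (by omega)

end IsCyclicLabeling

/-! ### Well-edge-dominated outerplanar graphs on at most seven vertices -/

instance : DecidableRel house.Adj := fun i j ↦
  decidable_of_iff (s(i, j) ∈ [s(0, 1), s(0, 2), s(2, 3), s(1, 3), s(3, 4), s(2, 4)] ∧ i ≠ j)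
    (by simp [house])

instance : DecidableRel dreamHouse.Adj := fun i j ↦
  decidable_of_iff (s(i, j) ∈ [s(0, 1), s(0, 2), s(1, 3), s(2, 3), s(2, 4), s(3, 5), s(4, 5),
    s(4, 6), s(5, 6)] ∧ i ≠ j) (by simp [dreamHouse])

instance : DecidableRel cycleSevenStar.Adj := fun i j ↦
  decidable_of_iff ((SimpleGraph.cycleGraph 7).Adj i j ∨ (i = 0 ∧ j = 3 ∨ i = 3 ∧ j = 0))
    (by rw [cycleSevenStar, SimpleGraph.sup_adj, SimpleGraph.edge_adj]
        refine or_congr_right ⟨fun h ↦ ⟨h, by rintro rfl; omega⟩, fun h ↦ h.1⟩)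

instance : DecidableRel (fan 5).Adj
  | .inl i, .inl j => .isFalse (by simp [fan, join, Subsingleton.elim i j])
  | .inl i, .inr j => .isTrue (by simp [fan, join])
  | .inr i, .inl j => .isTrue (by simp [fan, join])
  | .inr i, .inr j => decidable_of_iff (i.val + 1 = j.val ∨ j.val + 1 = i.val)
      (by simp [fan, join, SimpleGraph.pathGraph_adj])

namespace IsCyclicLabeling

variable {V W : Type*} {G : SimpleGraph V} {n : ℕ} {f : ℕ → V}

lemma nonempty_iso (hf : IsCyclicLabeling G n f) (hn : n ≠ 0) (hs : Function.Surjective f)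
    (H : SimpleGraph W) (g : Fin n → W) (hg : Function.Bijective g)
    (h : ∀ i j, ∀ hij : i < j, ∀ hj : j < n,
      (G.Adj (f i) (f j) ↔ H.Adj (g ⟨i, hij.trans hj⟩) (g ⟨j, hj⟩))) : Nonempty (G ≃g H) := by
  have hbij : Function.Bijective fun i : Fin n ↦ f i := by
    refine ⟨fun i j hij ↦ Fin.ext (hf.eq_of_lt (by omega) (by omega) hij), fun x ↦ ?_⟩
    obtain ⟨i, rfl⟩ := hs x
    obtain ⟨j, hj, hji⟩ := hf.exists_lt hn i
    exact ⟨⟨j, hj⟩, hji⟩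
  have key : ∀ i j : Fin n, H.Adj (g i) (g j) ↔ G.Adj (f i) (f j) := by
    intro i j
    rcases lt_trichotomy i j with hij | rfl | hij
    · exact (h i j hij j.2).symm
    · simp
    · rw [H.adj_comm, G.adj_comm]
      exact (h j i hij i.2).symm
  refine ⟨⟨(Equiv.ofBijective _ hbij).symm.trans (Equiv.ofBijective g hg), fun {x y} ↦ ?_⟩⟩
  obtain ⟨i, rfl⟩ := hbij.2 x
  obtain ⟨j, rfl⟩ := hbij.2 y
  have hi : ∀ i : Fin n, (Equiv.ofBijective _ hbij).symm (f i) = i :=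
    (Equiv.ofBijective _ hbij).symm_apply_apply
  simp only [Equiv.trans_apply, hi, Equiv.ofBijective_apply]
  exact key i j

lemma adj_wrap (hf : IsCyclicLabeling G n f) {i j : ℕ} :
    G.Adj (f i) (f (j + n)) ↔ G.Adj (f j) (f i) := by
  rw [hf.add_self, G.adj_comm]

/-- A 4-cycle with a chord has an edge that dominates all others, but also a perfect matching. -/
lemma not_chord_four [Finite V] (hf : IsCyclicLabeling G 4 f) (hs : Function.Surjective f)
    (hG : IsWellEdgeDominated G) (hout : IsOuterplanar G) : ¬ G.Adj (f 0) (f 2) := by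
  intro h
  obtain ⟨F₁, h₁, c₁⟩ := hf.exists_minimal_of_matching (by norm_num) hs {0, 2} (by simp) (by simp)
    (by
      intro u v huv hv hu hv' hi
      simp only [Finset.mem_insert, Finset.mem_singleton] at hu hv' hi
      have := hi (u - 1)
      have := hi (v - 1)
      omega)
  have hF : IsEdgeDominating G {s(f 0, f 2)} := by
    refine isEdgeDominating_iff.2 ⟨by simpa using h, fun e he ↦ ?_⟩
    obtain ⟨u, v, huv, hv, rfl, hadj⟩ := hf.exists_labels (by norm_num) hs he
    refine ⟨_, Finset.mem_singleton_self _, ?_⟩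
    interval_cases v <;> interval_cases u <;> first
      | (refine ⟨f 0, ?_, ?_⟩ <;> simp; done)
      | (refine ⟨f 2, ?_, ?_⟩ <;> simp; done)
      | exact (hf.not_crossing hout (by omega) (by omega) (by omega) (by omega) h hadj).elim
  obtain ⟨F₂, h₂, c₂⟩ := hF.exists_minimal
  have := hG F₁ F₂ h₁ h₂
  simp at c₁ c₂
  omega

lemma exists_minimal_card_three (hf : IsCyclicLabeling G 7 f) (hs : Function.Surjective f) :
    ∃ F, Minimal (IsEdgeDominating G) F ∧ F.card = 3 := by
  refine hf.exists_minimal_of_matching (by norm_num) hs {1, 3, 5} (by simp) (by simp) ?_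
  intro u v huv hv hu hv' hi
  simp only [Finset.mem_insert, Finset.mem_singleton] at hu hv' hi
  have := hi (u - 1)
  have := hi (v - 1)
  omega

/-- A chord that cuts off a triangle forces the opposite long chord: otherwise two edges would
dominate all others. -/
lemma adj_three_six [Finite V] (hf : IsCyclicLabeling G 7 f) (hs : Function.Surjective f)
    (hG : IsWellEdgeDominated G) (hout : IsOuterplanar G) (h : G.Adj (f 0) (f 2)) :
    G.Adj (f 3) (f 6) := by
  classical
  by_contra h'
  obtain ⟨F₁, h₁, c₁⟩ := hf.exists_minimal_card_three hs
  have hF : IsEdgeDominating G {s(f 0, f 2), s(f 4, f 5)} := by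
    refine isEdgeDominating_iff.2 ⟨by simpa using ⟨h, hf.adj 4⟩, fun e he ↦ ?_⟩
    obtain ⟨u, v, huv, hv, rfl, hadj⟩ := hf.exists_labels (by norm_num) hs he
    simp only [Finset.mem_insert, Finset.mem_singleton, exists_eq_or_imp, exists_eq_left]
    interval_cases v <;> interval_cases u <;> first
      | (refine Or.inl ⟨f 0, ?_, ?_⟩ <;> simp; done)
      | (refine Or.inl ⟨f 2, ?_, ?_⟩ <;> simp; done)
      | (refine Or.inr ⟨f 4, ?_, ?_⟩ <;> simp; done)
      | (refine Or.inr ⟨f 5, ?_, ?_⟩ <;> simp; done)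
      | exact absurd hadj h'
      | exact (hf.not_crossing hout (by omega) (by omega) (by omega) (by omega) h hadj).elim
  obtain ⟨F₂, h₂, c₂⟩ := hF.exists_minimal
  have := hG F₁ F₂ h₁ h₂
  have := Finset.card_le_two (a := s(f 0, f 2)) (b := s(f 4, f 5))
  omega

/-- Two long chords at a common vertex give a minimal edge dominating set that consists of two
paths of length two and leaves only that vertex uncovered. -/
lemma not_adj_three_adj_six (hf : IsCyclicLabeling G 7 f) (hs : Function.Surjective f)
    (hG : IsWellEdgeDominated G) (h : G.Adj (f 0) (f 3)) : ¬ G.Adj (f 3) (f 6) := by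
  classical
  intro h'
  obtain ⟨F₁, h₁, c₁⟩ := hf.exists_minimal_card_three hs
  have hinj : ∀ i j, i < 7 → j < 7 → (f i = f j ↔ i = j) := fun i j hi hj ↦
    ⟨hf.eq_of_lt (by omega) (by omega), congrArg f⟩
  have a0 := hf.adj 0
  have a1 := hf.adj 1
  have a2 := hf.adj 2
  have a3 := hf.adj 3
  have a4 := hf.adj 4
  have a5 := hf.adj 5
  simp only [Nat.reduceAdd] at a0 a1 a2 a3 a4 a5
  have h₂ : Minimal (IsEdgeDominating G)
      {s(f 0, f 1), s(f 1, f 2), s(f 4, f 5), s(f 5, f 6)} := by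
    refine minimal_isEdgeDominating_iff.2 ⟨isEdgeDominating_iff.2 ⟨?_, fun e he ↦ ?_⟩, ?_⟩
    · simp [a0, a1, a4, a5]
    · obtain ⟨u, v, huv, hv, rfl, hadj⟩ := hf.exists_labels (by norm_num) hs he
      simp only [Finset.mem_insert, Finset.mem_singleton, exists_eq_or_imp, exists_eq_left]
      interval_cases v <;> interval_cases u <;> simp
    · simp only [Finset.mem_insert, Finset.mem_singleton, forall_eq_or_imp, forall_eq]
      refine ⟨⟨s(f 0, f 3), h, ?_⟩, ⟨s(f 2, f 3), a2, ?_⟩, ⟨s(f 3, f 4), a3, ?_⟩,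
        ⟨s(f 3, f 6), h', ?_⟩⟩ <;> simp [hinj]
  have := hG F₁ _ h₁ h₂
  rw [c₁, Finset.card_insert_of_notMem (by simp [hinj]),
    Finset.card_insert_of_notMem (by simp [hinj]), Finset.card_insert_of_notMem (by simp [hinj]),
    Finset.card_singleton] at this
  omega

end IsCyclicLabeling

namespace IsCyclicLabeling

variable {V : Type*} {G : SimpleGraph V} {f : ℕ → V}

lemma iso_three (hf : IsCyclicLabeling G 3 f) (hs : Function.Surjective f) :
    Nonempty (G ≃g SimpleGraph.cycleGraph 3) := by
  have a0 : G.Adj (f 0) (f 1) := hf.adj 0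
  have a1 : G.Adj (f 1) (f 2) := hf.adj 1
  have a2 : G.Adj (f 0) (f 2) := hf.adj_wrap.1 (hf.adj 2)
  refine hf.nonempty_iso (by norm_num) hs _ id Function.bijective_id fun i j hij hj ↦ ?_
  interval_cases j <;> interval_cases i <;>
    exact iff_of_true (by assumption) (by decide +revert)

lemma iso_four [Finite V] (hf : IsCyclicLabeling G 4 f) (hs : Function.Surjective f)
    (hG : IsWellEdgeDominated G) (hout : IsOuterplanar G) :
    Nonempty (G ≃g SimpleGraph.cycleGraph 4) := by
  have a0 : G.Adj (f 0) (f 1) := hf.adj 0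
  have a1 : G.Adj (f 1) (f 2) := hf.adj 1
  have a2 : G.Adj (f 2) (f 3) := hf.adj 2
  have a3 : G.Adj (f 0) (f 3) := hf.adj_wrap.1 (hf.adj 3)
  have b0 : ¬ G.Adj (f 0) (f 2) := hf.not_chord_four hs hG hout
  have b1 : ¬ G.Adj (f 1) (f 3) :=
    (hf.shift 1).not_chord_four (hf.surjective_shift (by norm_num) hs 1) hG hout
  refine hf.nonempty_iso (by norm_num) hs _ id Function.bijective_id fun i j hij hj ↦ ?_
  interval_cases j <;> interval_cases i <;> first
    | exact iff_of_true (by assumption) (by decide +revert)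
    | exact iff_of_false (by assumption) (by decide +revert)

lemma iso_house_or_fan [Finite V] (hf : IsCyclicLabeling G 5 f) (hs : Function.Surjective f)
    (hout : IsOuterplanar G) (hc : G.Adj (f 0) (f 2)) :
    Nonempty (G ≃g house) ∨ Nonempty (G ≃g fan 5) := by
  have a0 : G.Adj (f 0) (f 1) := hf.adj 0
  have a1 : G.Adj (f 1) (f 2) := hf.adj 1
  have a2 : G.Adj (f 2) (f 3) := hf.adj 2
  have a3 : G.Adj (f 3) (f 4) := hf.adj 3
  have a4 : G.Adj (f 0) (f 4) := hf.adj_wrap.1 (hf.adj 4)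
  have b0 : ¬ G.Adj (f 1) (f 3) := fun h ↦
    hf.not_crossing hout (by omega) (by omega) (by omega) (by omega) hc h
  have b1 : ¬ G.Adj (f 1) (f 4) := fun h ↦
    hf.not_crossing hout (by omega) (by omega) (by omega) (by omega) hc h
  by_cases h1 : G.Adj (f 2) (f 4)
  · have b2 : ¬ G.Adj (f 0) (f 3) := fun h ↦
      hf.not_crossing hout (by omega) (by omega) (by omega) (by omega) h h1
    refine Or.inr (hf.nonempty_iso (by norm_num) hs _
      ![.inr 2, .inr 3, .inl 0, .inr 0, .inr 1] (by decide) fun i j hij hj ↦ ?_)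
    interval_cases j <;> interval_cases i <;> first
      | exact iff_of_true (by assumption) (by decide +revert)
      | exact iff_of_false (by assumption) (by decide +revert)
  · by_cases h2 : G.Adj (f 0) (f 3)
    · refine Or.inr (hf.nonempty_iso (by norm_num) hs _
        ![.inl 0, .inr 0, .inr 1, .inr 2, .inr 3] (by decide) fun i j hij hj ↦ ?_)
      interval_cases j <;> interval_cases i <;> first
        | exact iff_of_true (by assumption) (by decide +revert)
        | exact iff_of_false (by assumption) (by decide +revert)
    · refine Or.inl (hf.nonempty_iso (by norm_num) hs _
        ![2, 4, 3, 1, 0] (by decide) fun i j hij hj ↦ ?_)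
      interval_cases j <;> interval_cases i <;> first
        | exact iff_of_true (by assumption) (by decide +revert)
        | exact iff_of_false (by assumption) (by decide +revert)

lemma iso_five [Finite V] (hf : IsCyclicLabeling G 5 f) (hs : Function.Surjective f)
    (hout : IsOuterplanar G) : Nonempty (G ≃g SimpleGraph.cycleGraph 5) ∨
      Nonempty (G ≃g house) ∨ Nonempty (G ≃g fan 5) := by
  by_cases h : ∃ c, G.Adj (f c) (f (c + 2))
  · obtain ⟨c, hc⟩ := h
    exact Or.inr ((hf.shift c).iso_house_or_fan (hf.surjective_shift (by norm_num) hs c) hout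
      (by simpa [add_comm] using hc))
  push Not at h
  have a0 : G.Adj (f 0) (f 1) := hf.adj 0
  have a1 : G.Adj (f 1) (f 2) := hf.adj 1
  have a2 : G.Adj (f 2) (f 3) := hf.adj 2
  have a3 : G.Adj (f 3) (f 4) := hf.adj 3
  have a4 : G.Adj (f 0) (f 4) := hf.adj_wrap.1 (hf.adj 4)
  have b0 : ¬ G.Adj (f 0) (f 2) := h 0
  have b1 : ¬ G.Adj (f 1) (f 3) := h 1
  have b2 : ¬ G.Adj (f 2) (f 4) := h 2
  have b3 : ¬ G.Adj (f 0) (f 3) := fun h' ↦ h 3 (hf.adj_wrap.2 h')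
  have b4 : ¬ G.Adj (f 1) (f 4) := fun h' ↦ h 4 (hf.adj_wrap.2 h')
  refine Or.inl (hf.nonempty_iso (by norm_num) hs _ id Function.bijective_id
    fun i j hij hj ↦ ?_)
  interval_cases j <;> interval_cases i <;> first
    | exact iff_of_true (by assumption) (by decide +revert)
    | exact iff_of_false (by assumption) (by decide +revert)

/-- With a chord that cuts off a triangle, the only other chord is the opposite long one. -/
lemma iso_dreamHouse [Finite V] (hf : IsCyclicLabeling G 7 f) (hs : Function.Surjective f)
    (hG : IsWellEdgeDominated G) (hout : IsOuterplanar G) (hc : G.Adj (f 0) (f 2)) :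
    Nonempty (G ≃g dreamHouse) := by
  have hsh := hf.surjective_shift (by norm_num) hs
  have hA : ∀ c, G.Adj (f (0 + c)) (f (2 + c)) → G.Adj (f (3 + c)) (f (6 + c)) := fun c ↦
    (hf.shift c).adj_three_six (hsh c) hG hout
  have hB : ∀ c, G.Adj (f (0 + c)) (f (3 + c)) → ¬ G.Adj (f (3 + c)) (f (6 + c)) := fun c ↦
    (hf.shift c).not_adj_three_adj_six (hsh c) hG
  -- All other chords cross `02` or `36`, or are excluded by `hA` and `hB`.
  have hd := hA 0 hc
  simp only [add_zero] at hd
  have cr : ∀ {i j k l}, G.Adj (f i) (f k) → i < j ∧ j < k ∧ k < l ∧ l < i + 7 →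
      ¬ G.Adj (f j) (f l) := fun h ⟨a, b, c, d⟩ h' ↦ hf.not_crossing hout a b c d h h'
  have cr' : ∀ {i j k l}, G.Adj (f j) (f l) → i < j ∧ j < k ∧ k < l ∧ l < i + 7 →
      ¬ G.Adj (f i) (f k) := fun h' ⟨a, b, c, d⟩ h ↦ hf.not_crossing hout a b c d h h'
  have a0 : G.Adj (f 0) (f 1) := hf.adj 0
  have a1 : G.Adj (f 1) (f 2) := hf.adj 1
  have a2 : G.Adj (f 2) (f 3) := hf.adj 2
  have a3 : G.Adj (f 3) (f 4) := hf.adj 3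
  have a4 : G.Adj (f 4) (f 5) := hf.adj 4
  have a5 : G.Adj (f 5) (f 6) := hf.adj 5
  have a6 : G.Adj (f 0) (f 6) := hf.adj_wrap.1 (hf.adj 6)
  have b0 : ¬ G.Adj (f 0) (f 3) := fun h ↦ hB 0 h hd
  have b1 : ¬ G.Adj (f 2) (f 6) := fun h ↦ hB 3 hd (hf.adj_wrap.2 h)
  have b2 : ¬ G.Adj (f 3) (f 5) := fun h ↦ b1 (hf.adj_wrap.1 (hA 3 h))
  have b3 : ¬ G.Adj (f 4) (f 6) := fun h ↦ by
    have := hA 4 h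
    rw [show f (3 + 4) = f 0 from hf.add_self 0, show f (6 + 4) = f 3 from hf.add_self 3] at this
    exact b0 this
  refine hf.nonempty_iso (by norm_num) hs _ ![4, 6, 5, 3, 1, 0, 2] (by decide)
    fun i j hij hj ↦ ?_
  interval_cases j <;> interval_cases i <;> first
    | exact iff_of_true (by assumption) (by decide +revert)
    | exact iff_of_false (by assumption) (by decide +revert)
    | exact iff_of_false (cr hc (by omega)) (by decide +revert)
    | exact iff_of_false (cr' hd (by omega)) (by decide +revert)

/-- Without chords that cut off a triangle, there is at most one chord. -/
lemma iso_cycleSevenStar [Finite V] (hf : IsCyclicLabeling G 7 f) (hs : Function.Surjective f)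
    (hG : IsWellEdgeDominated G) (hout : IsOuterplanar G) (hc : G.Adj (f 0) (f 3))
    (h : ∀ c, ¬ G.Adj (f c) (f (c + 2))) : Nonempty (G ≃g cycleSevenStar) := by
  have hsh := hf.surjective_shift (by norm_num) hs
  have hB : ∀ c, G.Adj (f (0 + c)) (f (3 + c)) → ¬ G.Adj (f (3 + c)) (f (6 + c)) := fun c ↦
    (hf.shift c).not_adj_three_adj_six (hsh c) hG
  have cr : ∀ {j l}, 0 < j ∧ j < 3 ∧ 3 < l ∧ l < 0 + 7 →
      ¬ G.Adj (f j) (f l) := fun ⟨a, b, c, d⟩ h' ↦ hf.not_crossing hout a b c d hc h'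
  have a0 : G.Adj (f 0) (f 1) := hf.adj 0
  have a1 : G.Adj (f 1) (f 2) := hf.adj 1
  have a2 : G.Adj (f 2) (f 3) := hf.adj 2
  have a3 : G.Adj (f 3) (f 4) := hf.adj 3
  have a4 : G.Adj (f 4) (f 5) := hf.adj 4
  have a5 : G.Adj (f 5) (f 6) := hf.adj 5
  have a6 : G.Adj (f 0) (f 6) := hf.adj_wrap.1 (hf.adj 6)
  have b0 : ¬ G.Adj (f 3) (f 6) := hB 0 hc
  have b1 : ¬ G.Adj (f 0) (f 4) := fun h' ↦ hB 4 (hf.adj_wrap.2 h')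
    (by rw [show f (3 + 4) = f 0 from hf.add_self 0, show f (6 + 4) = f 3 from hf.add_self 3]
        exact hc)
  have b2 : ¬ G.Adj (f 0) (f 5) := fun h' ↦ h 5 (hf.adj_wrap.2 h')
  have h0 := h 0
  have h1 := h 1
  have h3 := h 3
  have h4 := h 4
  refine hf.nonempty_iso (by norm_num) hs _ id Function.bijective_id fun i j hij hj ↦ ?_
  interval_cases j <;> interval_cases i <;> first
    | exact iff_of_true (by assumption) (by decide +revert)
    | exact iff_of_false (by assumption) (by decide +revert)
    | exact iff_of_false (cr (by omega)) (by decide +revert)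

lemma iso_seven [Finite V] (hf : IsCyclicLabeling G 7 f) (hs : Function.Surjective f)
    (hG : IsWellEdgeDominated G) (hout : IsOuterplanar G) :
    Nonempty (G ≃g SimpleGraph.cycleGraph 7) ∨ Nonempty (G ≃g cycleSevenStar) ∨
      Nonempty (G ≃g dreamHouse) := by
  have hsh := hf.surjective_shift (by norm_num) hs
  by_cases h : ∃ c, G.Adj (f c) (f (c + 2))
  · obtain ⟨c, hc⟩ := h
    exact Or.inr (Or.inr ((hf.shift c).iso_dreamHouse (hsh c) hG hout
      (by simpa [add_comm] using hc)))
  push Not at h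
  by_cases h' : ∃ c, G.Adj (f c) (f (c + 3))
  · obtain ⟨c, hc⟩ := h'
    exact Or.inr (Or.inl ((hf.shift c).iso_cycleSevenStar (hsh c) hG hout
      (by simpa [add_comm] using hc) fun i ↦ by simpa [add_right_comm] using h (i + c)))
  push Not at h'
  have a0 : G.Adj (f 0) (f 1) := hf.adj 0
  have a1 : G.Adj (f 1) (f 2) := hf.adj 1
  have a2 : G.Adj (f 2) (f 3) := hf.adj 2
  have a3 : G.Adj (f 3) (f 4) := hf.adj 3
  have a4 : G.Adj (f 4) (f 5) := hf.adj 4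
  have a5 : G.Adj (f 5) (f 6) := hf.adj 5
  have a6 : G.Adj (f 0) (f 6) := hf.adj_wrap.1 (hf.adj 6)
  refine Or.inl (hf.nonempty_iso (by norm_num) hs _ id Function.bijective_id fun i j hij hj ↦ ?_)
  interval_cases j <;> interval_cases i <;> first
    | exact iff_of_true (by assumption) (by decide +revert)
    | exact iff_of_false (h _) (by decide +revert)
    | exact iff_of_false (h' _) (by decide +revert)
    | exact iff_of_false (fun e ↦ h _ (hf.adj_wrap.2 e)) (by decide +revert)
    | exact iff_of_false (fun e ↦ h' _ (hf.adj_wrap.2 e)) (by decide +revert)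

end IsCyclicLabeling

/-! ### The eight graphs are well-edge-dominated -/

/-- A graph with few edges is shown to be well-edge-dominated by a finite check. A set of edges is
encoded as the binary number `S`, in which bit `j` stands for the edge `ed j`, and `N i` encodes
the set of the edges that share a vertex with `ed i`. -/
lemma isWellEdgeDominated_of_masks {W : Type*} {m : ℕ} (H : SimpleGraph W) (ed : Fin m → Sym2 W)
    (hinj : Function.Injective ed) (hed : ∀ u v, H.Adj u v ↔ ∃ i, ed i = s(u, v))
    (N : Fin m → ℕ) (hN : ∀ i j : Fin m, (N i).testBit j = true ↔ ∃ v, v ∈ ed i ∧ v ∈ ed j) (k : ℕ)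
    (h : ∀ S < 2 ^ m, (∀ i, N i &&& S ≠ 0) →
      (∀ j : Fin m, S.testBit j = true → ∃ i, N i &&& S = 2 ^ j.val) →
      (Finset.univ.filter fun j : Fin m ↦ S.testBit j = true).card = k) :
    IsWellEdgeDominated H := by
  classical
  have hed' : ∀ e, e ∈ H.edgeSet ↔ ∃ i, ed i = e := fun e ↦ by
    induction e with | _ u v => exact hed u v
  suffices hk : ∀ F, Minimal (IsEdgeDominating H) F → F.card = k from
    fun F₁ F₂ h₁ h₂ ↦ (hk F₁ h₁).trans (hk F₂ h₂).symm
  intro F hF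
  rw [minimal_isEdgeDominating_iff, isEdgeDominating_iff] at hF
  obtain ⟨⟨h1, h2⟩, h3⟩ := hF
  set S := Nat.ofBits fun j : Fin m ↦ decide (ed j ∈ F) with hSdef
  have hS : ∀ j : Fin m, S.testBit j = decide (ed j ∈ F) := fun j ↦ by
    rw [hSdef, Nat.testBit_ofBits_lt _ _ j.2]
  have hS' : ∀ t, m ≤ t → S.testBit t = false := fun t ht ↦ Nat.testBit_ofBits_ge _ _ ht
  have hcard : F.card = (Finset.univ.filter fun j : Fin m ↦ S.testBit j = true).card := by
    rw [← Finset.card_image_of_injective _ hinj]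
    congr 1
    ext e
    simp only [Finset.mem_image, Finset.mem_filter, Finset.mem_univ, true_and, hS,
      decide_eq_true_eq]
    constructor
    · intro he
      obtain ⟨i, rfl⟩ := (hed' e).1 (h1 e he)
      exact ⟨i, he, rfl⟩
    · rintro ⟨i, hi, rfl⟩
      exact hi
  rw [hcard]
  refine h S (Nat.ofBits_lt_two_pow _) (fun i h0 ↦ ?_) fun j hj ↦ ?_
  · obtain ⟨f, hf, hv⟩ := h2 (ed i) ((hed' _).2 ⟨i, rfl⟩)
    obtain ⟨j, rfl⟩ := (hed' f).1 (h1 f hf)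
    have := congrArg (fun x ↦ x.testBit j) h0
    simp [hS, hf, (hN i j).2 hv] at this
  · have hjF : ed j ∈ F := by simpa [hS] using hj
    obtain ⟨e, he, hej⟩ := h3 _ hjF
    obtain ⟨i, rfl⟩ := (hed' e).1 he
    refine ⟨i, Nat.eq_of_testBit_eq fun t ↦ ?_⟩
    rw [Nat.testBit_and, Nat.testBit_two_pow]
    rcases Nat.lt_or_ge t m with ht | ht
    · have hS := hS ⟨t, ht⟩
      have hN := hN i ⟨t, ht⟩
      simp only at hS hN
      rw [hS, Bool.eq_iff_iff]
      simp only [Bool.and_eq_true, decide_eq_true_eq, hN]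
      constructor
      · rintro ⟨hv, htF⟩
        exact congrArg Fin.val (hinj (hej _ htF hv)).symm
      · rintro rfl
        refine ⟨?_, hjF⟩
        obtain ⟨f, hf, hv⟩ := h2 (ed i) he
        rwa [hej f hf hv] at hv
    · rw [hS' t ht, Bool.and_false, eq_comm, decide_eq_false_iff_not]
      omega

lemma isWellEdgeDominated_cycleGraph_three : IsWellEdgeDominated (SimpleGraph.cycleGraph 3) :=
  isWellEdgeDominated_of_masks _
    ![s(0, 1), s(1, 2), s(2, 0)]
    (by decide) (by decide) ![7, 7, 7] (by decide)
    1 (by decide +kernel)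

lemma isWellEdgeDominated_cycleGraph_four : IsWellEdgeDominated (SimpleGraph.cycleGraph 4) :=
  isWellEdgeDominated_of_masks _
    ![s(0, 1), s(1, 2), s(2, 3), s(3, 0)]
    (by decide) (by decide) ![11, 7, 14, 13] (by decide)
    2 (by decide +kernel)

lemma isWellEdgeDominated_cycleGraph_five : IsWellEdgeDominated (SimpleGraph.cycleGraph 5) :=
  isWellEdgeDominated_of_masks _
    ![s(0, 1), s(1, 2), s(2, 3), s(3, 4), s(4, 0)]
    (by decide) (by decide) ![19, 7, 14, 28, 25] (by decide)
    2 (by decide +kernel)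

lemma isWellEdgeDominated_cycleGraph_seven : IsWellEdgeDominated (SimpleGraph.cycleGraph 7) :=
  isWellEdgeDominated_of_masks _
    ![s(0, 1), s(1, 2), s(2, 3), s(3, 4), s(4, 5), s(5, 6), s(6, 0)]
    (by decide) (by decide) ![67, 7, 14, 28, 56, 112, 97] (by decide)
    3 (by decide +kernel)

lemma isWellEdgeDominated_house : IsWellEdgeDominated house :=
  isWellEdgeDominated_of_masks _
    ![s(0, 1), s(0, 2), s(2, 3), s(1, 3), s(3, 4), s(2, 4)]
    (by decide) (by decide) ![11, 39, 62, 29, 60, 54] (by decide)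
    2 (by decide +kernel)

lemma isWellEdgeDominated_fan_five : IsWellEdgeDominated (fan 5) :=
  isWellEdgeDominated_of_masks _
    ![s(.inl 0, .inr 0), s(.inl 0, .inr 1), s(.inl 0, .inr 2), s(.inl 0, .inr 3),
      s(.inr 0, .inr 1), s(.inr 1, .inr 2), s(.inr 2, .inr 3)]
    (by decide) (by decide) ![31, 63, 111, 79, 51, 118, 108] (by decide)
    2 (by decide +kernel)

lemma isWellEdgeDominated_cycleSevenStar : IsWellEdgeDominated cycleSevenStar :=
  isWellEdgeDominated_of_masks _
    ![s(0, 1), s(1, 2), s(2, 3), s(3, 4), s(4, 5), s(5, 6), s(6, 0), s(0, 3)]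
    (by decide) (by decide) ![195, 7, 142, 156, 56, 112, 225, 205] (by decide)
    3 (by decide +kernel)

lemma isWellEdgeDominated_dreamHouse : IsWellEdgeDominated dreamHouse :=
  isWellEdgeDominated_of_masks _
    ![s(0, 1), s(0, 2), s(1, 3), s(2, 3), s(2, 4), s(3, 5), s(4, 5), s(4, 6), s(5, 6)]
    (by decide) (by decide) ![7, 27, 45, 62, 218, 364, 496, 464, 480] (by decide)
    3 (by decide +kernel)

end WellEdgeDominated

theorem mainTheorem4 {V : Type*} [Fintype V] (G : SimpleGraph V)
    (hout : WellEdgeDominated.IsOuterplanar G) (hconn : WellEdgeDominated.IsTwoConnected G) :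
    WellEdgeDominated.IsWellEdgeDominated G ↔
      Nonempty (G ≃g SimpleGraph.cycleGraph 3) ∨
      Nonempty (G ≃g SimpleGraph.cycleGraph 4) ∨
      Nonempty (G ≃g SimpleGraph.cycleGraph 5) ∨
      Nonempty (G ≃g WellEdgeDominated.house) ∨
      Nonempty (G ≃g WellEdgeDominated.fan 5) ∨
      Nonempty (G ≃g SimpleGraph.cycleGraph 7) ∨
      Nonempty (G ≃g WellEdgeDominated.cycleSevenStar) ∨
      Nonempty (G ≃g WellEdgeDominated.dreamHouse) := by
  open WellEdgeDominated in
  constructor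
  · intro hG
    obtain ⟨n, hn, f, hf, hs⟩ := exists_hamiltonian_labeling hout hconn
    rcases hf.length_le_seven hs hG hout hn with rfl | rfl | rfl | rfl
    · exact Or.inl (hf.iso_three hs)
    · exact Or.inr (Or.inl (hf.iso_four hs hG hout))
    · have := hf.iso_five hs hout
      tauto
    · have := hf.iso_seven hs hG hout
      tauto
  · rintro (⟨⟨φ⟩⟩ | ⟨⟨φ⟩⟩ | ⟨⟨φ⟩⟩ | ⟨⟨φ⟩⟩ | ⟨⟨φ⟩⟩ | ⟨⟨φ⟩⟩ | ⟨⟨φ⟩⟩ | ⟨⟨φ⟩⟩)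
    · exact isWellEdgeDominated_cycleGraph_three.of_iso φ.symm
    · exact isWellEdgeDominated_cycleGraph_four.of_iso φ.symm
    · exact isWellEdgeDominated_cycleGraph_five.of_iso φ.symm
    · exact isWellEdgeDominated_house.of_iso φ.symm
    · exact isWellEdgeDominated_fan_five.of_iso φ.symm
    · exact isWellEdgeDominated_cycleGraph_seven.of_iso φ.symm
    · exact isWellEdgeDominated_cycleSevenStar.of_iso φ.symm
    · exact isWellEdgeDominated_dreamHouse.of_iso φ.symm
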